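/- Let $0<\alpha<1/2$ and let $Z=(Z_n)_{n\ge 0}=(X_n,Y_n)_{n\ge 0}$ be the Markov chain on $\mathbb{Z}_+^2$ started at $(1,1)$ with the following transition probabilities: from $(x,y)$ with $xy\neq 0$ it jumps to each of the four nearest neighbours with probability $\frac14$; for $i\ge 1$, $p((i,0),(i,1))=p((0,i),(1,i))=\frac{1}{2i^{\alpha}}$ and $p((i,0),(i+1,0))=p((0,i),(0,i+1))=1-\frac{1}{2i^{\alpha}}$; and $p((0,0),(1,0))=p((0,0),(0,1))=\frac12$. Put $\rho_0:=0$ and, for $i\ge 1$, $\eta_i:=\inf\{k>\rho_{i-1}: X_kY_k=0\}$ and $\rho_i:=\inf\{k>\eta_i: X_kY_k\neq 0\}$, and write $\overline{(x,y)}:=\max(x,y)$. Then every $\rho_i$ is almost surely finite, and $$\frac{\overline{Z}_{\rho_i}}{i^{1/(1-\alpha)}}\longrightarrow \mathbf{c}_1:=(2(1-\alpha))^{1/(1-\alpha)}\qquad\text{in probability as } i\to\infty .$$ -/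

import Mathlib

open MeasureTheory Filter

namespace AxisWalk

/-- One-step transition probabilities of the axis-driven walk on the first quadrant
`ℤ₊² = ℕ × ℕ` with parameter `α`: `transProb α z w` is the probability to jump from `z` to `w`. -/
noncomputable def transProb (α : ℝ) : ℕ × ℕ → ℕ × ℕ → ℝ
  | (0, 0), w => if w = (1, 0) ∨ w = (0, 1) then 1 / 2 else 0
  | (i + 1, 0), w =>
      if w = (i + 1, 1) then 1 / (2 * ((i + 1 : ℕ) : ℝ) ^ α)
      else if w = (i + 2, 0) then 1 - 1 / (2 * ((i + 1 : ℕ) : ℝ) ^ α)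
      else 0
  | (0, i + 1), w =>
      if w = (1, i + 1) then 1 / (2 * ((i + 1 : ℕ) : ℝ) ^ α)
      else if w = (0, i + 2) then 1 - 1 / (2 * ((i + 1 : ℕ) : ℝ) ^ α)
      else 0
  | (i + 1, j + 1), w =>
      if w = (i + 2, j + 1) ∨ w = (i, j + 1) ∨ w = (i + 1, j + 2) ∨ w = (i + 1, j) then 1 / 4
      else 0

/-- `Z` is, under `μ`, a Markov chain on `ℕ × ℕ` with transition probabilities `transProb α`,
started at `(1, 1)`. The Markov property is expressed on cylinder events, in product form:
`P(Z₀ = x₀, …, Zₙ = xₙ, Zₙ₊₁ = w) = P(Z₀ = x₀, …, Zₙ = xₙ) p(xₙ, w)`. -/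
structure IsAxisWalk {Ω : Type*} [MeasurableSpace Ω] (μ : Measure Ω) (α : ℝ)
    (Z : ℕ → Ω → ℕ × ℕ) : Prop where
  measurable : ∀ n, Measurable (Z n)
  start : ∀ᵐ ω ∂μ, Z 0 ω = (1, 1)
  markov : ∀ (n : ℕ) (x : ℕ → ℕ × ℕ) (w : ℕ × ℕ),
    μ.real {ω | (∀ k ≤ n, Z k ω = x k) ∧ Z (n + 1) ω = w} =
      μ.real {ω | ∀ k ≤ n, Z k ω = x k} * transProb α (x n) w

/-- The axes `{(x, y) : x y = 0}` of the quadrant. -/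
def axes : Set (ℕ × ℕ) := {z | z.1 * z.2 = 0}

/-- The open cone `{(x, y) : x y ≠ 0}`. -/
def cone : Set (ℕ × ℕ) := {z | z.1 * z.2 ≠ 0}

/-- `inf {k > t : z k ∈ S}`, for a trajectory `z`; it is `⊤` when there is no such `k`. -/
noncomputable def firstAfter (z : ℕ → ℕ × ℕ) (S : Set (ℕ × ℕ)) (t : ℕ∞) : ℕ∞ :=
  ⨅ (k : ℕ) (_ : t < (k : ℕ∞) ∧ z k ∈ S), (k : ℕ∞)

/-- The return times `ρ_i` from the axes into the cone: `ρ_0 = 0` and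
`ρ_{i+1} = inf {k > η_{i+1} : z k ∈ cone}`, where `η_{i+1} = inf {k > ρ_i : z k ∈ axes}`. -/
noncomputable def rho (z : ℕ → ℕ × ℕ) : ℕ → ℕ∞
  | 0 => 0
  | i + 1 => firstAfter z cone (firstAfter z axes (rho z i))

/-- The dominant coordinate of a point. -/
def dom (z : ℕ × ℕ) : ℕ := max z.1 z.2

end AxisWalk

/-! Cut the trajectory into phases, alternately in the cone and on the axes. Write `S` for the sum
of the coordinates at the start of a phase. In the cone `S` is a martingale, so an excursion leaves
its mean essentially unchanged. On an axis at distance `x` the walk runs outwards for about `2 x ^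
α` steps. A cycle thus adds about `2 S ^ α` to `S`, hence about `2 (1 - α)` to `S ^ (1 - α)`, which
predicts `S ^ (1 - α) ≈ 2 (1 - α) i` after `i` cycles.

Concentration comes from two moments rather than from a variance. If nonnegative `X` has mean
asymptotically at most `c` while the mean of `X ^ q`, `0 < q < 1`, is asymptotically at least `c ^
q`, strict concavity forces `X → c` in probability (`tendstoInMeasure_of_moments`). It is applied
with `q = 1 - α`.

Upper bound for the mean: the martingale property, a supermartingale on the axes and Jensen's
inequality give `y' ≤ y + 6 + 2 (y + 2) ^ α` for the means over one cycle
(`integral_size_even_succ_le`). This recursion integrates to `y ^ (1 - α) ≤ (2 (1 - α) + o(1)) n`.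

Lower bound for the mean of the power: `(S + A) ^ (1 - α)` is concave and loses mean in the cone.
Subtracting `4 x y w(x + y)` turns it into a submartingale there; the correction vanishes on the
axes and costs at most `4 A ^ (-α)` at the exit points, which is small for large `A`. The gain on
the axes tends to `2 (1 - α)` far from the origin (`integral_shiftedPow_add_le`). Cycles that start
near the origin gain less, but are rare: a corrected logarithm gains at least a positive amount in
each of them, while its mean is `O(log n)` (`eventually_sum_logGain_le`).

All phases end almost surely by a Foster–Lyapunov argument, and optional stopping extends to
functions of sublinear growth by comparison with the Lyapunov functions. -/

namespace AxisWalk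

set_option linter.unusedSectionVars false

/-! ### Phases of a deterministic trajectory -/

/-- The set in which the walk lives during its `j`-th phase. -/
def phaseSet (j : ℕ) : Set (ℕ × ℕ) := if Even j then cone else axes

/-- The time at which the `j`-th phase of a trajectory begins. -/
noncomputable def crossing (z : ℕ → ℕ × ℕ) : ℕ → ℕ∞
  | 0 => 0
  | j + 1 => firstAfter z (phaseSet (j + 1)) (crossing z j)

theorem phaseSet_even (i : ℕ) : phaseSet (2 * i) = cone := by simp [phaseSet]

theorem phaseSet_odd (i : ℕ) : phaseSet (2 * i + 1) = axes := by simp [phaseSet]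

theorem mem_phaseSet_of_notMem_succ {j : ℕ} {z : ℕ × ℕ} (h : z ∉ phaseSet (j + 1)) :
    z ∈ phaseSet j := by
  unfold phaseSet at *
  rcases Nat.even_or_odd j with hj | hj
  · rw [if_neg (by simpa using Nat.even_add_one.not.2 (by simpa using hj))] at h
    simpa [hj, axes, cone] using h
  · rw [if_pos (by simpa [Nat.even_add_one] using hj)] at h
    rw [if_neg (by simpa using hj)]
    simp only [axes, cone, Set.mem_ofPred_eq, ne_eq, not_not] at h ⊢
    exact h

theorem rho_eq_crossing (z : ℕ → ℕ × ℕ) (i : ℕ) : rho z i = crossing z (2 * i) := by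
  induction i with
  | zero => rfl
  | succ i ih =>
    have h1 : crossing z (2 * (i + 1)) = firstAfter z (phaseSet (2 * (i + 1)))
      (firstAfter z (phaseSet (2 * i + 1)) (crossing z (2 * i))) := rfl
    rw [h1, phaseSet_even, phaseSet_odd, ← ih]; rfl

/-- Comparing only with finite times avoids any discussion of the value `⊤`. -/
theorem firstAfter_le_iff (z : ℕ → ℕ × ℕ) (S : Set (ℕ × ℕ)) (t : ℕ∞) (n : ℕ) :
    firstAfter z S t ≤ n ↔ ∃ k ≤ n, t < (k : ℕ∞) ∧ z k ∈ S := by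
  have h0 : firstAfter z S t ≤ n ↔ firstAfter z S t < ((n + 1 : ℕ) : ℕ∞) := by
    rw [Nat.cast_add, Nat.cast_one, ENat.lt_add_one_iff (ENat.natCast_ne_top n)]
  rw [h0, firstAfter]
  simp only [iInf_lt_iff, Nat.cast_lt]
  constructor
  · rintro ⟨k, hk, hlt⟩; exact ⟨k, by omega, hk⟩
  · rintro ⟨k, hlt, hk⟩; exact ⟨k, hk, by omega⟩

theorem not_crossing_succ_le_zero (z : ℕ → ℕ × ℕ) (j : ℕ) :
    ¬ crossing z (j + 1) ≤ (0 : ℕ) := by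
  rw [crossing, firstAfter_le_iff]
  rintro ⟨k, hk, hlt, -⟩
  obtain rfl : k = 0 := by omega
  simp at hlt

/-- A recursion in time: it makes each crossing a stopping time and yields the one-step descriptions
of `InPhase` and `Enters`. -/
theorem crossing_le_succ_iff (z : ℕ → ℕ × ℕ) (j n : ℕ) :
    crossing z (j + 1) ≤ (n + 1 : ℕ) ↔ crossing z (j + 1) ≤ n ∨
      (crossing z j ≤ n ∧ z (n + 1) ∈ phaseSet (j + 1)) := by
  rw [crossing, firstAfter_le_iff, firstAfter_le_iff]
  constructor
  · rintro ⟨k, hk, hlt, hS⟩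
    rcases Nat.lt_or_ge k (n + 1) with h | h
    · exact Or.inl ⟨k, by omega, hlt, hS⟩
    · obtain rfl : k = n + 1 := by omega
      refine Or.inr ⟨?_, hS⟩
      rwa [Nat.cast_add, Nat.cast_one, ENat.lt_add_one_iff (ENat.natCast_ne_top n)] at hlt
  · rintro (⟨k, hk, hlt, hS⟩ | ⟨hle, hS⟩)
    · exact ⟨k, by omega, hlt, hS⟩
    · refine ⟨n + 1, le_rfl, ?_, hS⟩
      rwa [Nat.cast_add, Nat.cast_one, ENat.lt_add_one_iff (ENat.natCast_ne_top n)]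

theorem crossing_le_of_succ_le {z : ℕ → ℕ × ℕ} {j n : ℕ} (h : crossing z (j + 1) ≤ n) :
    crossing z j ≤ n := by
  rw [crossing, firstAfter_le_iff] at h
  obtain ⟨k, hk, hlt, -⟩ := h
  exact hlt.le.trans (by exact_mod_cast hk)

theorem crossing_le_congr {z z' : ℕ → ℕ × ℕ} (n : ℕ) (h : ∀ k ≤ n, z k = z' k) (j : ℕ) :
    crossing z j ≤ n ↔ crossing z' j ≤ n := by
  induction n generalizing j with
  | zero =>
    cases j with
    | zero => simp [crossing]
    | succ j => simp only [not_crossing_succ_le_zero]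
  | succ n ih =>
    cases j with
    | zero => simp [crossing]
    | succ j =>
      rw [crossing_le_succ_iff, crossing_le_succ_iff, ih (fun k hk => h k (by omega)),
        ih (fun k hk => h k (by omega)), h (n + 1) le_rfl]

/-- The trajectory is in its `j`-th phase at time `n`. -/
def InPhase (z : ℕ → ℕ × ℕ) (j n : ℕ) : Prop := crossing z j ≤ n ∧ ¬ crossing z (j + 1) ≤ n

/-- The trajectory enters its `j`-th phase at time `n`. -/
def Enters (z : ℕ → ℕ × ℕ) (j n : ℕ) : Prop := crossing z j = n

theorem enters_succ_iff {z : ℕ → ℕ × ℕ} {j n : ℕ} :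
    Enters z j (n + 1) ↔ crossing z j ≤ (n + 1 : ℕ) ∧ ¬ crossing z j ≤ n := by
  rw [Enters, not_le, le_antisymm_iff, ← Order.add_one_le_iff_of_not_isMax (by simp)]
  norm_cast

theorem enters_zero_iff {z : ℕ → ℕ × ℕ} {j : ℕ} :
    Enters z j 0 ↔ crossing z j ≤ (0 : ℕ) := by
  simp [Enters]

theorem enters_succ_succ_iff {z : ℕ → ℕ × ℕ} {j n : ℕ} :
    Enters z (j + 1) (n + 1) ↔ InPhase z j n ∧ z (n + 1) ∈ phaseSet (j + 1) := by
  rw [enters_succ_iff, crossing_le_succ_iff, InPhase]; tauto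

theorem inPhase_succ_iff {z : ℕ → ℕ × ℕ} {j n : ℕ} :
    InPhase z j (n + 1) ↔ (InPhase z j n ∧ z (n + 1) ∉ phaseSet (j + 1)) ∨ Enters z j (n + 1) := by
  rw [enters_succ_iff, InPhase, InPhase, crossing_le_succ_iff]
  have h1 : crossing z (j + 1) ≤ n → crossing z j ≤ n := crossing_le_of_succ_le
  have h2 : crossing z j ≤ n → crossing z j ≤ (n + 1 : ℕ) :=
    fun h => h.trans (by exact_mod_cast Nat.le_succ n)
  tauto

theorem InPhase.mem {z : ℕ → ℕ × ℕ} (h0 : z 0 ∈ cone) {j n : ℕ} (h : InPhase z j n) :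
    z n ∈ phaseSet j := by
  cases n with
  | zero =>
    cases j with
    | zero => simpa [phaseSet] using h0
    | succ j => exact absurd h.1 (not_crossing_succ_le_zero z j)
  | succ n =>
    rcases inPhase_succ_iff.1 h with h | h
    · exact mem_phaseSet_of_notMem_succ h.2
    · cases j with
      | zero => simp [Enters, crossing] at h; norm_cast at h
      | succ j => exact (enters_succ_succ_iff.1 h).2

theorem Enters.mem {z : ℕ → ℕ × ℕ} (h0 : z 0 ∈ cone) {j n : ℕ} (h : Enters z j n) :
    z n ∈ phaseSet j := by
  cases j with
  | zero =>
    obtain rfl : n = 0 := by simpa [Enters, crossing, eq_comm] using h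
    simpa [phaseSet] using h0
  | succ j =>
    cases n with
    | zero => exact absurd (enters_zero_iff.1 h) (not_crossing_succ_le_zero z j)
    | succ n => exact (enters_succ_succ_iff.1 h).2

theorem inPhase_congr {z z' : ℕ → ℕ × ℕ} {n : ℕ} (h : ∀ k ≤ n, z k = z' k) (j : ℕ) :
    InPhase z j n ↔ InPhase z' j n := by
  simp only [InPhase, crossing_le_congr n h]

theorem enters_congr {z z' : ℕ → ℕ × ℕ} {n : ℕ} (h : ∀ k ≤ n, z k = z' k) (j : ℕ) :
    Enters z j n ↔ Enters z' j n := by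
  cases n with
  | zero => rw [enters_zero_iff, enters_zero_iff, crossing_le_congr 0 h]
  | succ n => rw [enters_succ_iff, enters_succ_iff, crossing_le_congr (n + 1) h,
      crossing_le_congr n (fun k hk => h k (by omega))]

/-! ### The Markov property and the balance inequality over a phase -/

/-- The transition operator of the walk, acting on `[0, ∞]`-valued functions. -/
noncomputable def step (α : ℝ) (H : ℕ × ℕ → ENNReal) (z : ℕ × ℕ) : ENNReal :=
  ∑' w, ENNReal.ofReal (transProb α z w) * H w

section Markov
variable {Ω : Type*} [MeasurableSpace Ω] {μ : Measure Ω} [IsProbabilityMeasure μ]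
  {α : ℝ} {Z : ℕ → Ω → ℕ × ℕ}

/-- The initial segment of length `n + 1` of the trajectory. -/
def initialPath (Z : ℕ → Ω → ℕ × ℕ) (n : ℕ) (ω : Ω) : Fin (n + 1) → ℕ × ℕ := fun k => Z k ω

theorem IsAxisWalk.measurable_initialPath (hZ : IsAxisWalk μ α Z) (n : ℕ) :
    Measurable (initialPath Z n) :=
  measurable_pi_lambda _ fun k => hZ.measurable k

theorem IsAxisWalk.measure_initialPath_succ (hZ : IsAxisWalk μ α Z) (n : ℕ)
    (x : Fin (n + 1) → ℕ × ℕ) (w : ℕ × ℕ) :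
    μ {ω | initialPath Z n ω = x ∧ Z (n + 1) ω = w} =
      μ {ω | initialPath Z n ω = x} * ENNReal.ofReal (transProb α (x (Fin.last n)) w) := by
  -- The truncated index `min k n` extends a finite path to the infinite sequence that the Markov
  -- property takes; only its first `n + 1` terms matter.
  have h := hZ.markov n (fun k => x ⟨min k n, by omega⟩) w
  have he : ∀ ω, (∀ k ≤ n, Z k ω = x ⟨min k n, by omega⟩) ↔ initialPath Z n ω = x := by
    intro ω
    constructor
    · intro h
      funext k
      have := h k (by omega)
      simp only [initialPath, this]
      congr 1; ext; simp; omega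
    · rintro rfl k hk
      simp [initialPath, hk]
  simp only [he] at h
  have hl : (⟨min n n, by omega⟩ : Fin (n + 1)) = Fin.last n := by ext; simp
  rw [hl] at h
  rw [← ofReal_measureReal, h, ENNReal.ofReal_mul measureReal_nonneg, ofReal_measureReal]

/-- Paths of a given length form a countable set, so both integrals are sums over cylinders, and the
Markov property compares them term by term. -/
theorem IsAxisWalk.lintegral_initialPath_succ (hZ : IsAxisWalk μ α Z) (n : ℕ)
    (G : (Fin (n + 1) → ℕ × ℕ) → ℕ × ℕ → ENNReal) :
    ∫⁻ ω, G (initialPath Z n ω) (Z (n + 1) ω) ∂μ =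
      ∫⁻ ω, step α (G (initialPath Z n ω)) (Z n ω) ∂μ := by
  have hm := hZ.measurable_initialPath n
  have hm2 : Measurable fun ω => (initialPath Z n ω, Z (n + 1) ω) := hm.prodMk (hZ.measurable _)
  have h1 : ∫⁻ ω, G (initialPath Z n ω) (Z (n + 1) ω) ∂μ =
      ∫⁻ p, G p.1 p.2 ∂(μ.map fun ω => (initialPath Z n ω, Z (n + 1) ω)) :=
    (lintegral_map (f := fun p : (Fin (n + 1) → ℕ × ℕ) × (ℕ × ℕ) => G p.1 p.2)
      (Measurable.of_discrete) hm2).symm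
  have h2 : ∫⁻ ω, step α (G (initialPath Z n ω)) (Z n ω) ∂μ =
      ∫⁻ x, step α (G x) (x (Fin.last n)) ∂(μ.map (initialPath Z n)) :=
    (lintegral_map (f := fun x : Fin (n + 1) → ℕ × ℕ => step α (G x) (x (Fin.last n)))
      (Measurable.of_discrete) hm).symm
  rw [h1, h2, lintegral_countable', lintegral_countable',
    ENNReal.summable.tsum_prod' fun _ => ENNReal.summable]
  refine tsum_congr fun x => ?_
  rw [step, ← ENNReal.tsum_mul_right]
  refine tsum_congr fun w => ?_
  rw [Measure.map_apply hm2 (MeasurableSet.singleton _),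
    Measure.map_apply hm (MeasurableSet.singleton _)]
  have := hZ.measure_initialPath_succ n x w
  have e1 : (fun ω => (initialPath Z n ω, Z (n + 1) ω)) ⁻¹' {(x, w)} =
      {ω | initialPath Z n ω = x ∧ Z (n + 1) ω = w} := by ext; simp
  have e2 : initialPath Z n ⁻¹' {x} = {ω | initialPath Z n ω = x} := rfl
  rw [e1, e2, this]
  simp only
  ring

/-- The event that the walk is in its `j`-th phase at time `n`. -/
def inPhaseEvent (Z : ℕ → Ω → ℕ × ℕ) (j n : ℕ) : Set Ω := {ω | InPhase (fun k => Z k ω) j n}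

/-- The event that the walk enters its `j`-th phase at time `n`. -/
def entersEvent (Z : ℕ → Ω → ℕ × ℕ) (j n : ℕ) : Set Ω := {ω | Enters (fun k => Z k ω) j n}

theorem eq_preimage_initialPath (P : (ℕ → ℕ × ℕ) → Prop) (n : ℕ)
    (hP : ∀ z z' : ℕ → ℕ × ℕ, (∀ k ≤ n, z k = z' k) → (P z ↔ P z')) :
    {ω | P fun k => Z k ω} =
      initialPath Z n ⁻¹' {x | P fun k => x ⟨min k n, by omega⟩} := by
  ext ω
  refine hP _ _ fun k hk => ?_
  simp [initialPath, hk]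

theorem IsAxisWalk.measurableSet_inPhaseEvent (hZ : IsAxisWalk μ α Z) (j n : ℕ) :
    MeasurableSet (inPhaseEvent Z j n) := by
  rw [inPhaseEvent, eq_preimage_initialPath (fun z => InPhase z j n) n
    fun z z' h => inPhase_congr h j]
  exact hZ.measurable_initialPath n (MeasurableSet.of_discrete)

theorem IsAxisWalk.measurableSet_entersEvent (hZ : IsAxisWalk μ α Z) (j n : ℕ) :
    MeasurableSet (entersEvent Z j n) := by
  rw [entersEvent, eq_preimage_initialPath (fun z => Enters z j n) n
    fun z z' h => enters_congr h j]
  exact hZ.measurable_initialPath n (MeasurableSet.of_discrete)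

theorem IsAxisWalk.setLIntegral_inPhase_succ (hZ : IsAxisWalk μ α Z) (j n : ℕ)
    (H : ℕ × ℕ → ENNReal) :
    ∫⁻ ω in inPhaseEvent Z j n, H (Z (n + 1) ω) ∂μ =
      ∫⁻ ω in inPhaseEvent Z j n, step α H (Z n ω) ∂μ := by
  classical
  have hms := hZ.measurableSet_inPhaseEvent j n
  rw [← lintegral_indicator hms, ← lintegral_indicator hms]
  set A : Set (Fin (n + 1) → ℕ × ℕ) := {x | InPhase (fun k => x ⟨min k n, by omega⟩) j n} with hA
  have hpre : inPhaseEvent Z j n = initialPath Z n ⁻¹' A :=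
    eq_preimage_initialPath (fun z => InPhase z j n) n fun z z' h => inPhase_congr h j
  have h := hZ.lintegral_initialPath_succ n fun x w => if x ∈ A then H w else 0
  have hmem : ∀ ω, ω ∈ inPhaseEvent Z j n ↔ initialPath Z n ω ∈ A := fun ω => by rw [hpre]; rfl
  convert h using 3 with ω ω
  · simp only [Set.indicator_apply, hmem]
  · simp only [Set.indicator_apply, hmem]
    split_ifs with hω
    · rfl
    · simp [step]

theorem entersEvent_succ_succ (j n : ℕ) :
    entersEvent Z (j + 1) (n + 1) =
      inPhaseEvent Z j n ∩ {ω | Z (n + 1) ω ∈ phaseSet (j + 1)} := by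
  ext ω; exact enters_succ_succ_iff

theorem inPhaseEvent_succ (j n : ℕ) :
    inPhaseEvent Z j (n + 1) =
      (inPhaseEvent Z j n ∩ {ω | Z (n + 1) ω ∈ phaseSet (j + 1)}ᶜ) ∪ entersEvent Z j (n + 1) := by
  ext ω; exact inPhase_succ_iff

theorem IsAxisWalk.ae_start_mem_cone (hZ : IsAxisWalk μ α Z) : ∀ᵐ ω ∂μ, Z 0 ω ∈ cone := by
  filter_upwards [hZ.start] with ω h
  simp [h, cone]

/-- A balance inequality: a function that decreases in mean by at least `g` during the `j`-th phase
is estimated at the end of the phase, or at a fixed time, by its value at the start of the phase. -/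
theorem IsAxisWalk.sum_enters_succ_le (hZ : IsAxisWalk μ α Z) (j : ℕ) {H g : ℕ × ℕ → ENNReal}
    (hH : ∀ z ∈ phaseSet j, step α H z + g z ≤ H z) (N : ℕ) :
    ∑ k ∈ Finset.range (N + 1), ∫⁻ ω in entersEvent Z (j + 1) k, H (Z k ω) ∂μ +
      ∑ k ∈ Finset.range N, ∫⁻ ω in inPhaseEvent Z j k, g (Z k ω) ∂μ +
      ∫⁻ ω in inPhaseEvent Z j N, H (Z N ω) ∂μ ≤
    ∑ k ∈ Finset.range (N + 1), ∫⁻ ω in entersEvent Z j k, H (Z k ω) ∂μ := by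
  induction N with
  | zero =>
    have h1 : entersEvent Z (j + 1) 0 = ∅ := by
      ext ω
      simp only [entersEvent, Set.mem_ofPred_eq, enters_zero_iff, Set.mem_empty_iff_false, iff_false]
      exact not_crossing_succ_le_zero _ _
    have h2 : inPhaseEvent Z j 0 ⊆ entersEvent Z j 0 := fun ω h => enters_zero_iff.2 h.1
    simpa [h1] using lintegral_mono_set h2
  | succ N ih =>
    rw [Finset.sum_range_succ _ (N + 1), Finset.sum_range_succ
      (fun k => ∫⁻ ω in inPhaseEvent Z j k, g (Z k ω) ∂μ) N, Finset.sum_range_succ _ (N + 1)]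
    have hmS : MeasurableSet {ω | Z (N + 1) ω ∈ phaseSet (j + 1)} :=
      hZ.measurable (N + 1) (MeasurableSet.of_discrete)
    -- One step from inside the phase. The walk then either enters the next phase or stays, and this
    -- splits the left side below.
    have hstep : ∫⁻ ω in inPhaseEvent Z j N, H (Z (N + 1) ω) ∂μ +
        ∫⁻ ω in inPhaseEvent Z j N, g (Z N ω) ∂μ ≤ ∫⁻ ω in inPhaseEvent Z j N, H (Z N ω) ∂μ := by
      rw [hZ.setLIntegral_inPhase_succ, ← lintegral_add_left]
      · refine setLIntegral_mono_ae' (hZ.measurableSet_inPhaseEvent j N) ?_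
        filter_upwards [hZ.ae_start_mem_cone] with ω h0 hω
        exact hH _ (InPhase.mem (z := fun k => Z k ω) h0 hω)
      · exact (Measurable.of_discrete (f := step α H)).comp (hZ.measurable N)
    have hsplit : ∫⁻ ω in inPhaseEvent Z j N, H (Z (N + 1) ω) ∂μ =
        ∫⁻ ω in entersEvent Z (j + 1) (N + 1), H (Z (N + 1) ω) ∂μ +
        ∫⁻ ω in inPhaseEvent Z j N ∩ {ω | Z (N + 1) ω ∈ phaseSet (j + 1)}ᶜ,
          H (Z (N + 1) ω) ∂μ := by
      rw [entersEvent_succ_succ, ← Set.sdiff_eq]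
      exact (lintegral_inter_add_sdiff _ _ hmS).symm
    have hunion : ∫⁻ ω in inPhaseEvent Z j (N + 1), H (Z (N + 1) ω) ∂μ ≤
        ∫⁻ ω in inPhaseEvent Z j N ∩ {ω | Z (N + 1) ω ∈ phaseSet (j + 1)}ᶜ, H (Z (N + 1) ω) ∂μ +
        ∫⁻ ω in entersEvent Z j (N + 1), H (Z (N + 1) ω) ∂μ := by
      rw [inPhaseEvent_succ]
      exact lintegral_union_le _ _ _
    rw [hsplit] at hstep
    generalize (∫⁻ ω in entersEvent Z (j + 1) (N + 1), H (Z (N + 1) ω) ∂μ) = a at *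
    generalize (∫⁻ ω in inPhaseEvent Z j N ∩ {ω | Z (N + 1) ω ∈ phaseSet (j + 1)}ᶜ,
      H (Z (N + 1) ω) ∂μ) = b at *
    generalize (∫⁻ ω in entersEvent Z j (N + 1), H (Z (N + 1) ω) ∂μ) = c at *
    generalize (∫⁻ ω in inPhaseEvent Z j (N + 1), H (Z (N + 1) ω) ∂μ) = d at *
    generalize (∫⁻ ω in inPhaseEvent Z j N, g (Z N ω) ∂μ) = e at *
    generalize (∫⁻ ω in inPhaseEvent Z j N, H (Z N ω) ∂μ) = f at *
    generalize (∑ k ∈ Finset.range (N + 1), ∫⁻ ω in entersEvent Z (j + 1) k, H (Z k ω) ∂μ) = s at *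
    generalize (∑ k ∈ Finset.range N, ∫⁻ ω in inPhaseEvent Z j k, g (Z k ω) ∂μ) = t at *
    calc s + a + (t + e) + d ≤ s + a + (t + e) + (b + c) := by gcongr
      _ = s + t + (a + b + e) + c := by ring
      _ ≤ s + t + f + c := by gcongr
      _ ≤ _ := by gcongr

end Markov

/-! ### The transition operator on real functions -/

/-- The probability to leave an axis at distance `i` from the origin. -/
noncomputable def exitProb (α : ℝ) (i : ℕ) : ℝ := 1 / (2 * (i : ℝ) ^ α)

/-- The transition operator of the walk, acting on real functions. -/
noncomputable def meanStep (α : ℝ) (F : ℕ × ℕ → ℝ) : ℕ × ℕ → ℝ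
  | (0, 0) => (F (1, 0) + F (0, 1)) / 2
  | (i + 1, 0) => exitProb α (i + 1) * F (i + 1, 1) + (1 - exitProb α (i + 1)) * F (i + 2, 0)
  | (0, i + 1) => exitProb α (i + 1) * F (1, i + 1) + (1 - exitProb α (i + 1)) * F (0, i + 2)
  | (i + 1, j + 1) => (F (i + 2, j + 1) + F (i, j + 1) + F (i + 1, j + 2) + F (i + 1, j)) / 4

theorem exitProb_nonneg (α : ℝ) (i : ℕ) : 0 ≤ exitProb α i := by unfold exitProb; positivity

theorem exitProb_le_half {α : ℝ} (hα : 0 ≤ α) (i : ℕ) : exitProb α (i + 1) ≤ 1 / 2 := by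
  unfold exitProb
  have : (1 : ℝ) ≤ ((i + 1 : ℕ) : ℝ) ^ α := Real.one_le_rpow (by push_cast; linarith [i.cast_nonneg (α := ℝ)]) hα
  exact one_div_le_one_div_of_le (by norm_num) (by linarith)

theorem step_ofReal {α : ℝ} (hα : 0 ≤ α) {F : ℕ × ℕ → ℝ} (hF : ∀ z, 0 ≤ F z) (z : ℕ × ℕ) :
    step α (fun w => ENNReal.ofReal (F w)) z = ENNReal.ofReal (meanStep α F z) := by
  have hsum : ∀ s : Finset (ℕ × ℕ), (∀ w ∉ s, transProb α z w = 0) →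
      (∀ w ∈ s, 0 ≤ transProb α z w) →
      step α (fun w => ENNReal.ofReal (F w)) z =
        ENNReal.ofReal (∑ w ∈ s, transProb α z w * F w) := by
    intro s hs hp
    rw [step, tsum_eq_sum (s := s) fun w hw => by rw [hs w hw]; simp,
      ENNReal.ofReal_sum_of_nonneg fun w hw => mul_nonneg (hp w hw) (hF w)]
    exact Finset.sum_congr rfl fun w hw => (ENNReal.ofReal_mul (hp w hw)).symm
  rcases z with ⟨_ | i, _ | j⟩
  · rw [hsum {(1, 0), (0, 1)}]
    · congr 1
      rw [Finset.sum_pair (by simp)]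
      simp [transProb, meanStep]; ring
    · intro w hw
      simp only [Finset.mem_insert, Finset.mem_singleton] at hw
      simp [transProb, hw]
    · intro w _
      simp only [transProb]; split_ifs <;> norm_num
  · have h1 := exitProb_nonneg α (j + 1)
    have h2 := exitProb_le_half hα j
    unfold exitProb at h1 h2
    rw [hsum {(1, j + 1), (0, j + 2)}]
    · congr 1
      rw [Finset.sum_pair (by simp)]
      simp [transProb, meanStep, exitProb]
    · intro w hw
      simp only [Finset.mem_insert, Finset.mem_singleton, not_or] at hw
      simp [transProb, hw]
    · intro w _
      simp only [transProb]; split_ifs <;> linarith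
  · have h1 := exitProb_nonneg α (i + 1)
    have h2 := exitProb_le_half hα i
    unfold exitProb at h1 h2
    rw [hsum {(i + 1, 1), (i + 2, 0)}]
    · congr 1
      rw [Finset.sum_pair (by simp)]
      simp [transProb, meanStep, exitProb]
    · intro w hw
      simp only [Finset.mem_insert, Finset.mem_singleton, not_or] at hw
      simp [transProb, hw]
    · intro w _
      simp only [transProb]; split_ifs <;> linarith
  · rw [hsum {(i + 2, j + 1), (i, j + 1), (i + 1, j + 2), (i + 1, j)}]
    · congr 1
      rw [Finset.sum_insert (by simp), Finset.sum_insert (by simp), Finset.sum_pair (by simp)]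
      simp [transProb, meanStep]; ring
    · intro w hw
      simp only [Finset.mem_insert, Finset.mem_singleton] at hw
      simp [transProb, hw]
    · intro w _
      simp only [transProb]; split_ifs <;> norm_num

/-- The weights add up to `1`, so constants are preserved. This is the combination used in optional
stopping for sublinear functions. -/
theorem meanStep_combination (α K ε : ℝ) (F V : ℕ × ℕ → ℝ) (z : ℕ × ℕ) :
    meanStep α (fun w => K + ε * V w - F w) z = K + ε * meanStep α V z - meanStep α F z := by
  rcases z with ⟨_ | i, _ | j⟩ <;> simp only [meanStep] <;> ring

/-! ### Starting points of the phases, and termination of a phase -/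

/-- The sum of the two coordinates. -/
def size (z : ℕ × ℕ) : ℕ := z.1 + z.2

theorem finite_size_le (K : ℕ) : {z : ℕ × ℕ | size z ≤ K}.Finite := by
  refine (Set.finite_Iic ((K, K) : ℕ × ℕ)).subset fun z hz => ?_
  simp only [size, Set.mem_ofPred_eq] at hz
  exact ⟨by simp; omega, by simp; omega⟩

section Chain
variable {Ω : Type*} [MeasurableSpace Ω] {μ : Measure Ω} [IsProbabilityMeasure μ]
  {α : ℝ} {Z : ℕ → Ω → ℕ × ℕ}

/-- The position of the walk at the beginning of its `j`-th phase. -/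
noncomputable def phaseStart (Z : ℕ → Ω → ℕ × ℕ) (j : ℕ) (ω : Ω) : ℕ × ℕ :=
  Z (crossing (fun k => Z k ω) j).toNat ω

theorem mem_entersEvent {j n : ℕ} {ω : Ω} :
    ω ∈ entersEvent Z j n ↔ crossing (fun k => Z k ω) j = n := Iff.rfl

theorem iUnion_entersEvent (j : ℕ) :
    ⋃ n, entersEvent Z j n = {ω | crossing (fun k => Z k ω) j < ⊤} := by
  ext ω
  simp only [Set.mem_iUnion, mem_entersEvent, Set.mem_ofPred_eq, lt_top_iff_ne_top,
    ENat.ne_top_iff_exists, eq_comm]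

theorem pairwise_disjoint_entersEvent (j : ℕ) : Pairwise (Function.onFun Disjoint (entersEvent Z j)) := by
  intro m n hmn
  rw [Function.onFun, Set.disjoint_left]
  intro ω hm hn
  rw [mem_entersEvent] at hm hn
  exact hmn (by exact_mod_cast hm.symm.trans hn)

theorem IsAxisWalk.measurable_phaseStart (hZ : IsAxisWalk μ α Z) (j : ℕ) :
    Measurable (phaseStart Z j) := by
  refine measurable_to_countable' fun w => ?_
  -- Where the crossing time is `⊤`, its `toNat` is `0` and the phase start is the position at time
  -- `0`.
  have h : phaseStart Z j ⁻¹' {w} = (⋃ n, entersEvent Z j n ∩ Z n ⁻¹' {w}) ∪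
      ((⋃ n, entersEvent Z j n)ᶜ ∩ Z 0 ⁻¹' {w}) := by
    ext ω
    by_cases hω : crossing (fun k => Z k ω) j = ⊤
    · have : ∀ n, ω ∉ entersEvent Z j n := fun n hn => by
        rw [mem_entersEvent, hω] at hn; exact absurd hn (by simp)
      simp [phaseStart, hω, this]
    · obtain ⟨n, hn⟩ := ENat.ne_top_iff_exists.1 hω
      have h1 : ∀ m, ω ∈ entersEvent Z j m ↔ n = m := fun m => by
        rw [mem_entersEvent, ← hn]; norm_cast
      simp [phaseStart, ← hn, h1]
  rw [h]
  exact (MeasurableSet.iUnion fun n => (hZ.measurableSet_entersEvent j n).inter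
    (hZ.measurable n (MeasurableSet.singleton w))).union
    ((MeasurableSet.iUnion fun n => hZ.measurableSet_entersEvent j n).compl.inter
      (hZ.measurable 0 (MeasurableSet.singleton w)))

theorem IsAxisWalk.lintegral_phaseStart (hZ : IsAxisWalk μ α Z) {j : ℕ}
    (hfin : ∀ᵐ ω ∂μ, crossing (fun k => Z k ω) j < ⊤) (H : ℕ × ℕ → ENNReal) :
    ∫⁻ ω, H (phaseStart Z j ω) ∂μ = ∑' n, ∫⁻ ω in entersEvent Z j n, H (Z n ω) ∂μ := by
  have h1 : ∫⁻ ω, H (phaseStart Z j ω) ∂μ =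
      ∫⁻ ω in ⋃ n, entersEvent Z j n, H (phaseStart Z j ω) ∂μ := by
    rw [← setLIntegral_univ]
    refine setLIntegral_congr ?_
    rw [iUnion_entersEvent]
    filter_upwards [hfin] with ω hω
    exact propext ⟨fun _ => hω, fun _ => trivial⟩
  rw [h1, lintegral_iUnion (hZ.measurableSet_entersEvent j) (pairwise_disjoint_entersEvent j)]
  refine tsum_congr fun n => setLIntegral_congr_fun (hZ.measurableSet_entersEvent j n) ?_
  intro ω hω
  rw [mem_entersEvent] at hω
  simp [phaseStart, hω]

/-- If the mean of `H ≥ size` strictly decreases during the `j`-th phase, then this phase ends. -/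
theorem IsAxisWalk.crossing_succ_lt_top (hZ : IsAxisWalk μ α Z) {j : ℕ}
    (hfin : ∀ᵐ ω ∂μ, crossing (fun k => Z k ω) j < ⊤) {H g : ℕ × ℕ → ENNReal}
    (hH : ∀ z ∈ phaseSet j, step α H z + g z ≤ H z) (hg : ∀ z ∈ phaseSet j, 0 < g z)
    (hS : ∀ z, (size z : ENNReal) ≤ H z)
    (hint : ∫⁻ ω, H (phaseStart Z j ω) ∂μ ≠ ⊤) :
    ∀ᵐ ω ∂μ, crossing (fun k => Z k ω) (j + 1) < ⊤ := by
  set E := ∫⁻ ω, H (phaseStart Z j ω) ∂μ with hE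
  have hpart : ∀ N, ∑ k ∈ Finset.range N, ∫⁻ ω in inPhaseEvent Z j k, g (Z k ω) ∂μ +
      ∫⁻ ω in inPhaseEvent Z j N, H (Z N ω) ∂μ ≤ E := by
    intro N
    calc _ ≤ ∑ k ∈ Finset.range (N + 1), ∫⁻ ω in entersEvent Z (j + 1) k, H (Z k ω) ∂μ +
      ∑ k ∈ Finset.range N, ∫⁻ ω in inPhaseEvent Z j k, g (Z k ω) ∂μ +
      ∫⁻ ω in inPhaseEvent Z j N, H (Z N ω) ∂μ := by
          rw [add_assoc]; exact le_add_self
      _ ≤ _ := hZ.sum_enters_succ_le j hH N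
      _ ≤ E := by
        rw [hE, hZ.lintegral_phaseStart hfin]
        exact ENNReal.sum_le_tsum _
  have hsum : ∑' k, ∫⁻ ω in inPhaseEvent Z j k, g (Z k ω) ∂μ ≤ E :=
    ENNReal.tsum_le_of_sum_range_le fun N => le_self_add.trans (hpart N)
  have htend : Tendsto (fun k => ∫⁻ ω in inPhaseEvent Z j k, g (Z k ω) ∂μ) atTop (nhds 0) :=
    ENNReal.tendsto_atTop_zero_of_tsum_ne_top (ne_top_of_le_ne_top hint hsum)
  -- A walk still in the phase is either in the finite set `size ≤ K`, where `g` is bounded below by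
  -- some `c > 0`, or has `H ≥ size ≥ K`, which Markov's inequality makes unlikely.
  have hbound : ∀ K : ℕ, 0 < K → ∃ c : ENNReal, 0 < c ∧ c ≠ ⊤ ∧ ∀ N, μ (inPhaseEvent Z j N) ≤
      c⁻¹ * ∫⁻ ω in inPhaseEvent Z j N, g (Z N ω) ∂μ + E / K := by
    intro K hK
    obtain ⟨c, hc0, hct, hc⟩ : ∃ c : ENNReal, 0 < c ∧ c ≠ ⊤ ∧
        ∀ z ∈ phaseSet j, size z ≤ K → c ≤ g z := by
      have hf : ({z | size z ≤ K} ∩ phaseSet j).Finite := (finite_size_le K).inter_of_left _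
      rcases ({z | size z ≤ K} ∩ phaseSet j).eq_empty_or_nonempty with he | hne
      · refine ⟨1, one_pos, ENNReal.one_ne_top, fun z hz hz' => ?_⟩
        exact absurd (show z ∈ ({z | size z ≤ K} ∩ phaseSet j) from ⟨hz', hz⟩) (by simp [he])
      · obtain ⟨z₀, hz₀, hmin⟩ := Set.exists_min_image _ g hf hne
        refine ⟨min 1 (g z₀), lt_min one_pos (hg z₀ hz₀.2), by simp, fun z hz hz' => ?_⟩
        exact (min_le_right _ _).trans (hmin z ⟨hz', hz⟩)
    refine ⟨c, hc0, hct, fun N => ?_⟩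
    have hm := hZ.measurableSet_inPhaseEvent j N
    calc μ (inPhaseEvent Z j N) = ∫⁻ ω in inPhaseEvent Z j N, 1 ∂μ := by simp
      _ ≤ ∫⁻ ω in inPhaseEvent Z j N, (c⁻¹ * g (Z N ω) + H (Z N ω) / K) ∂μ := by
        refine setLIntegral_mono_ae' hm ?_
        filter_upwards [hZ.ae_start_mem_cone] with ω h0 hω
        have hmem := InPhase.mem (z := fun k => Z k ω) h0 hω
        rcases le_total (size (Z N ω)) K with h | h
        · refine le_trans ?_ le_self_add
          rw [← ENNReal.inv_mul_cancel hc0.ne' hct]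
          gcongr
          exact hc _ hmem h
        · refine le_trans ?_ le_add_self
          rw [ENNReal.le_div_iff_mul_le (by simp [hK.ne']) (by simp), one_mul]
          exact le_trans (by exact_mod_cast h) (hS _)
      _ = c⁻¹ * ∫⁻ ω in inPhaseEvent Z j N, g (Z N ω) ∂μ +
          (∫⁻ ω in inPhaseEvent Z j N, H (Z N ω) ∂μ) / K := by
        have hmg : Measurable fun ω => g (Z N ω) := (Measurable.of_discrete (f := g)).comp (hZ.measurable N)
        have hmH : Measurable fun ω => H (Z N ω) := (Measurable.of_discrete (f := H)).comp (hZ.measurable N)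
        rw [lintegral_add_left (hmg.const_mul _), lintegral_const_mul _ hmg]
        simp only [div_eq_mul_inv]
        rw [lintegral_mul_const _ hmH]
      _ ≤ _ := by
        gcongr
        exact le_add_self.trans (hpart N)
  have hzero : Tendsto (fun N => μ (inPhaseEvent Z j N)) atTop (nhds 0) := by
    rw [ENNReal.tendsto_nhds_zero]
    intro ε hε
    obtain ⟨K, hK0, hK⟩ : ∃ K : ℕ, 0 < K ∧ E / K ≤ ε / 2 := by
      have : Tendsto (fun K : ℕ => E / K) atTop (nhds 0) := by
        have := ENNReal.Tendsto.const_div (a := E) ENNReal.tendsto_nat_nhds_top (Or.inr hint)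
        simpa using this
      have h2 := (ENNReal.tendsto_nhds_zero.1 this) (ε / 2) (by simpa using hε.ne')
      obtain ⟨K, h3, h4⟩ := (h2.and (eventually_gt_atTop 0)).exists
      exact ⟨K, h4, h3⟩
    obtain ⟨c, hc0, hct, hc⟩ := hbound K hK0
    have h3 : Tendsto (fun N => c⁻¹ * ∫⁻ ω in inPhaseEvent Z j N, g (Z N ω) ∂μ) atTop (nhds 0) := by
      have := ENNReal.Tendsto.const_mul htend (Or.inr (ENNReal.inv_ne_top.2 hc0.ne'))
      simpa using this
    filter_upwards [(ENNReal.tendsto_nhds_zero.1 h3) (ε / 2) (by simpa using hε.ne')] with N hN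
    calc _ ≤ _ := hc N
      _ ≤ ε / 2 + ε / 2 := add_le_add hN hK
      _ = ε := ENNReal.add_halves ε
  -- A phase that has begun by time `n` and never ends is in progress at every later time.
  have hnull : ∀ n : ℕ, μ {ω | crossing (fun k => Z k ω) j ≤ n ∧
      crossing (fun k => Z k ω) (j + 1) = ⊤} = 0 := by
    intro n
    refine le_antisymm (ge_of_tendsto hzero ?_) zero_le
    filter_upwards [eventually_ge_atTop n] with N hN
    refine measure_mono fun ω hω => ⟨hω.1.trans (by exact_mod_cast hN), ?_⟩
    simp [hω.2]
  have hall : ∀ᵐ ω ∂μ, ∀ n : ℕ, ¬ (crossing (fun k => Z k ω) j ≤ n ∧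
      crossing (fun k => Z k ω) (j + 1) = ⊤) :=
    ae_all_iff.2 fun n => by
      rw [ae_iff]; simpa using hnull n
  filter_upwards [hfin, hall] with ω h1 h2
  rw [lt_top_iff_ne_top] at h1 ⊢
  obtain ⟨n, hn⟩ := ENat.ne_top_iff_exists.1 h1
  exact fun h => h2 n ⟨hn.ge, h⟩

/-- Optional stopping for a nonnegative supermartingale: drop the remaining terms of the balance
inequality and let the time horizon grow. -/
theorem IsAxisWalk.lintegral_phaseStart_succ_le (hZ : IsAxisWalk μ α Z) {j : ℕ}
    (hfin : ∀ᵐ ω ∂μ, crossing (fun k => Z k ω) j < ⊤)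
    (hfin' : ∀ᵐ ω ∂μ, crossing (fun k => Z k ω) (j + 1) < ⊤) {H : ℕ × ℕ → ENNReal}
    (hH : ∀ z ∈ phaseSet j, step α H z ≤ H z) :
    ∫⁻ ω, H (phaseStart Z (j + 1) ω) ∂μ ≤ ∫⁻ ω, H (phaseStart Z j ω) ∂μ := by
  rw [hZ.lintegral_phaseStart hfin, hZ.lintegral_phaseStart hfin']
  refine ENNReal.tsum_le_of_sum_range_le fun N => ?_
  refine le_trans ?_ (ENNReal.sum_le_tsum (Finset.range (N + 1)))
  refine le_trans ?_ (hZ.sum_enters_succ_le j (g := 0) (by simpa using hH) N)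
  rw [Finset.sum_range_succ, add_assoc, add_assoc]
  exact le_self_add

theorem IsAxisWalk.ae_phaseStart_mem (hZ : IsAxisWalk μ α Z) {j : ℕ}
    (hfin : ∀ᵐ ω ∂μ, crossing (fun k => Z k ω) j < ⊤) :
    ∀ᵐ ω ∂μ, phaseStart Z j ω ∈ phaseSet j := by
  filter_upwards [hfin, hZ.ae_start_mem_cone] with ω h h0
  obtain ⟨n, hn⟩ := ENat.ne_top_iff_exists.1 h.ne
  have := Enters.mem (z := fun k => Z k ω) h0 (j := j) (n := n) hn.symm
  simpa [phaseStart, ← hn] using this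

end Chain

/-! ### Lyapunov functions for the cone and the axes -/

theorem meanStep_nonneg {α : ℝ} (hα : 0 ≤ α) {F : ℕ × ℕ → ℝ} (hF : ∀ z, 0 ≤ F z) (z : ℕ × ℕ) :
    0 ≤ meanStep α F z := by
  rcases z with ⟨_ | i, _ | j⟩ <;> simp only [meanStep]
  · linarith [hF (1, 0), hF (0, 1)]
  · have h1 := exitProb_nonneg α (j + 1)
    have h2 := exitProb_le_half hα j
    exact add_nonneg (mul_nonneg h1 (hF _)) (mul_nonneg (by linarith) (hF _))
  · have h1 := exitProb_nonneg α (i + 1)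
    have h2 := exitProb_le_half hα i
    exact add_nonneg (mul_nonneg h1 (hF _)) (mul_nonneg (by linarith) (hF _))
  · linarith [hF (i + 2, j + 1), hF (i, j + 1), hF (i + 1, j + 2), hF (i + 1, j)]

theorem step_ofReal_add_le {α : ℝ} (hα : 0 ≤ α) {F g : ℕ × ℕ → ℝ} (hF : ∀ z, 0 ≤ F z)
    {z : ℕ × ℕ} (hg : 0 ≤ g z) (h : meanStep α F z + g z ≤ F z) :
    step α (fun w => ENNReal.ofReal (F w)) z + ENNReal.ofReal (g z) ≤ ENNReal.ofReal (F z) := by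
  rw [step_ofReal hα hF, ← ENNReal.ofReal_add (meanStep_nonneg hα hF z) hg]
  exact ENNReal.ofReal_le_ofReal h

/-- The function that is a function `l` of the size on the axes, and `c` inside the cone. -/
noncomputable def glue (l : ℕ → ℝ) (c : ℕ × ℕ → ℝ) (z : ℕ × ℕ) : ℝ :=
  if z.1 * z.2 = 0 then l (size z) else c z

theorem glue_of_mem_axes (l : ℕ → ℝ) (c : ℕ × ℕ → ℝ) {z : ℕ × ℕ} (hz : z ∈ axes) :
    glue l c z = l (size z) := if_pos hz

theorem glue_of_mem_cone (l : ℕ → ℝ) (c : ℕ × ℕ → ℝ) {z : ℕ × ℕ} (hz : z ∈ cone) :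
    glue l c z = c z := if_neg hz

/-- From an axis the cone is entered only at height one, so only the values of `c` there matter. By
symmetry both axes reduce to a walk on the half-line. -/
theorem meanStep_glue (α : ℝ) (l f : ℕ → ℝ) {c : ℕ × ℕ → ℝ}
    (hc : ∀ i : ℕ, c (i + 1, 1) = f (i + 1) ∧ c (1, i + 1) = f (i + 1)) {z : ℕ × ℕ}
    (hz : z ∈ axes) :
    (size z = 0 ∧ meanStep α (glue l c) z = l 1) ∨
      ∃ i : ℕ, size z = i + 1 ∧ meanStep α (glue l c) z =
        exitProb α (i + 1) * f (i + 1) + (1 - exitProb α (i + 1)) * l (i + 2) := by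
  rcases z with ⟨_ | i, _ | j⟩
  · left; simp [size, meanStep, glue]
  · right; exact ⟨j, by simp [size], by simp [meanStep, glue, size, hc]⟩
  · right; exact ⟨i, by simp [size], by simp [meanStep, glue, size, hc]⟩
  · simp [axes] at hz

theorem exists_of_mem_cone {z : ℕ × ℕ} (hz : z ∈ cone) : ∃ i j : ℕ, z = (i + 1, j + 1) := by
  rcases z with ⟨_ | i, _ | j⟩
  · simp [cone] at hz
  · simp [cone] at hz
  · simp [cone] at hz
  · exact ⟨i, j, rfl⟩

/-- A function `≥ size` whose mean strictly decreases inside the cone. -/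
noncomputable def coneLyapunov (z : ℕ × ℕ) : ℝ := (size z : ℝ) + 1 - 1 / (size z : ℝ)

/-- A bound for the mean size of the walk when it leaves an axis, in terms of its position. -/
noncomputable def axisBound (α : ℝ) (s : ℕ) : ℝ :=
  ((if s = 0 then 2 else s : ℕ) : ℝ) + 2 * ((if s = 0 then 2 else s : ℕ) : ℝ) ^ α + 4

/-- A function `≥ size` whose mean strictly decreases on the axes. -/
noncomputable def axisLyapunov (α : ℝ) : ℕ × ℕ → ℝ := glue (axisBound α) fun z => size z

/-- By Bernoulli the increment of `x ^ α` is at most `α x ^ (α - 1)`. As `2 α ≤ 1`, this is at most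
`x ^ (-α) / 2`, the exit probability. -/
theorem rpow_succ_le {α : ℝ} (hα0 : 0 ≤ α) (hα1 : α ≤ 1 / 2) (i : ℕ) :
    ((i + 2 : ℕ) : ℝ) ^ α ≤ ((i + 1 : ℕ) : ℝ) ^ α + exitProb α (i + 1) := by
  have hx : (0 : ℝ) < ((i + 1 : ℕ) : ℝ) := by positivity
  set x : ℝ := ((i + 1 : ℕ) : ℝ) with hxdef
  have hx1 : (1 : ℝ) ≤ x := by rw [hxdef]; exact_mod_cast Nat.succ_le_succ (Nat.zero_le i)
  have ha : 0 < x ^ α := Real.rpow_pos_of_pos hx _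
  have h2 : ((i + 2 : ℕ) : ℝ) = x * (1 + 1 / x) := by
    rw [hxdef]; push_cast; field_simp; ring
  have hx' : 0 < 1 / x := by positivity
  have hB : (1 + 1 / x) ^ α ≤ 1 + α * (1 / x) :=
    rpow_one_add_le_one_add_mul_self (by linarith) hα0 (by linarith)
  have hsq : x ^ α * x ^ α ≤ x := by
    rw [← Real.rpow_add hx]
    calc x ^ (α + α) ≤ x ^ (1 : ℝ) := Real.rpow_le_rpow_of_exponent_le hx1 (by linarith)
      _ = x := Real.rpow_one x
  rw [h2, Real.mul_rpow hx.le (by positivity), exitProb]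
  calc x ^ α * (1 + 1 / x) ^ α ≤ x ^ α * (1 + α * (1 / x)) := by gcongr
    _ = x ^ α + α * (x ^ α / x) := by ring
    _ ≤ x ^ α + 1 / 2 * (1 / x ^ α) := by
      have : x ^ α / x ≤ 1 / x ^ α := by
        rw [div_le_div_iff₀ hx ha]; linarith
      gcongr
    _ = _ := by rw [← hxdef]; field_simp

theorem mul_exitProb {α : ℝ} (i : ℕ) :
    ((i + 1 : ℕ) : ℝ) ^ α * exitProb α (i + 1) = 1 / 2 := by
  have : 0 < ((i + 1 : ℕ) : ℝ) ^ α := Real.rpow_pos_of_pos (by positivity) _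
  rw [exitProb]; field_simp

theorem exitProb_pos (α : ℝ) (i : ℕ) : 0 < exitProb α (i + 1) := by
  have : 0 < ((i + 1 : ℕ) : ℝ) ^ α := Real.rpow_pos_of_pos (by positivity) _
  rw [exitProb]; positivity

/-- The term `2 x ^ α` is the inverse of the exit probability, the expected number of steps if that
probability were frozen; the constant absorbs its variation. Giving the origin the value of the
point `2` makes the forced step from the origin to distance one a strict decrease too. -/
theorem exists_meanStep_axisLyapunov_le {α : ℝ} (hα0 : 0 ≤ α) (hα1 : α ≤ 1 / 2) {z : ℕ × ℕ}
    (hz : z ∈ axes) :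
    ∃ g > 0, meanStep α (axisLyapunov α) z + g ≤ axisLyapunov α z := by
  rw [axisLyapunov, glue_of_mem_axes _ _ hz]
  rcases meanStep_glue α (axisBound α) (fun i => (i + 1 : ℕ)) (c := fun z => size z)
    (fun i => by simp [size]; ring) hz with ⟨hs, h⟩ | ⟨i, hs, h⟩
  · refine ⟨1, one_pos, ?_⟩
    rw [h, hs]
    have : (1 : ℝ) ≤ 2 ^ α := Real.one_le_rpow (by norm_num) hα0
    simp [axisBound]; linarith
  · refine ⟨exitProb α (i + 1), exitProb_pos α i, ?_⟩
    rw [h, hs]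
    have h1 := rpow_succ_le hα0 hα1 i
    have h2 := mul_exitProb (α := α) i
    have h3 := exitProb_pos α i
    have h4 := exitProb_le_half hα0 i
    simp only [axisBound, if_neg (Nat.succ_ne_zero _)]
    generalize ((i + 1 : ℕ) : ℝ) ^ α = a at *
    generalize exitProb α (i + 1) = p at *
    have h5 : (1 - p) * ((i + 2 : ℕ) : ℝ) ^ α ≤ (1 - p) * (a + p) := by
      gcongr; linarith
    push_cast at h5 ⊢
    nlinarith

/-- The size is a martingale in the cone, and strict concavity of `-1 / s` supplies the strict
decrease. -/
theorem exists_meanStep_coneLyapunov_le (α : ℝ) {z : ℕ × ℕ} (hz : z ∈ cone) :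
    ∃ g > 0, meanStep α coneLyapunov z + g ≤ coneLyapunov z := by
  obtain ⟨i, j, rfl⟩ := exists_of_mem_cone hz
  set u : ℝ := i + j + 2 with hu
  have hu2 : 2 ≤ u := by rw [hu]; have := i.cast_nonneg (α := ℝ); have := j.cast_nonneg (α := ℝ); linarith
  refine ⟨1 / (u * (u ^ 2 - 1)), ?_, le_of_eq ?_⟩
  · have : 0 < u ^ 2 - 1 := by nlinarith
    positivity
  · simp only [meanStep, coneLyapunov, size]
    push_cast
    have e1 : (i : ℝ) + 2 + (j + 1) = u + 1 := by rw [hu]; ring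
    have e2 : (i : ℝ) + (j + 1) = u - 1 := by rw [hu]; ring
    have e3 : (i : ℝ) + 1 + (j + 2) = u + 1 := by rw [hu]; ring
    have e4 : (i : ℝ) + 1 + j = u - 1 := by rw [hu]; ring
    have e5 : (i : ℝ) + 1 + (j + 1) = u := by rw [hu]; ring
    rw [e1, e2, e3, e4, e5]
    have h1 : u - 1 ≠ 0 := by linarith
    have h2 : u + 1 ≠ 0 := by linarith
    have h3 : u ≠ 0 := by linarith
    have h4 : u ^ 2 - 1 ≠ 0 := by nlinarith
    have h5 : u ^ 2 - 1 = (u - 1) * (u + 1) := by ring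
    rw [h5]
    field_simp
    ring

/-- The Lyapunov function that is used during the `j`-th phase. -/
noncomputable def lyapunov (α : ℝ) (j : ℕ) : ℕ × ℕ → ℝ :=
  if Even j then coneLyapunov else axisLyapunov α

theorem exists_meanStep_lyapunov_le {α : ℝ} (hα0 : 0 ≤ α) (hα1 : α ≤ 1 / 2) {j : ℕ} {z : ℕ × ℕ}
    (hz : z ∈ phaseSet j) :
    ∃ g > 0, meanStep α (lyapunov α j) z + g ≤ lyapunov α j z := by
  unfold lyapunov
  unfold phaseSet at hz
  split_ifs at hz ⊢
  · exact exists_meanStep_coneLyapunov_le α hz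
  · exact exists_meanStep_axisLyapunov_le hα0 hα1 hz

theorem axisBound_le {α : ℝ} (hα0 : 0 ≤ α) (s : ℕ) :
    axisBound α s ≤ (s : ℝ) + 6 + 2 * ((s : ℝ) + 2) ^ α := by
  unfold axisBound
  have h : ((if s = 0 then 2 else s : ℕ) : ℝ) ≤ s + 2 := by
    split_ifs with h <;> simp [h]
  have := Real.rpow_le_rpow (by positivity) h hα0
  linarith

theorem size_le_lyapunov (α : ℝ) (j : ℕ) (z : ℕ × ℕ) : (size z : ℝ) ≤ lyapunov α j z := by
  unfold lyapunov
  split_ifs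
  · unfold coneLyapunov
    rcases Nat.eq_zero_or_pos (size z) with h | h
    · simp [h]
    · have : 1 / (size z : ℝ) ≤ 1 := by
        rw [div_le_one (by positivity)]; exact_mod_cast h
      linarith
  · unfold axisLyapunov glue
    split_ifs
    · unfold axisBound
      have h : (size z : ℝ) ≤ ((if size z = 0 then 2 else size z : ℕ) : ℝ) := by
        split_ifs with h <;> simp [h]
      have : 0 ≤ ((if size z = 0 then 2 else size z : ℕ) : ℝ) ^ α := by positivity
      linarith
    · exact le_rfl

theorem lyapunov_nonneg (α : ℝ) (j : ℕ) (z : ℕ × ℕ) : 0 ≤ lyapunov α j z :=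
  (Nat.cast_nonneg _).trans (size_le_lyapunov α j z)

theorem lyapunov_le {α : ℝ} (hα0 : 0 ≤ α) (hα1 : α ≤ 1 / 2) (j : ℕ) (z : ℕ × ℕ) :
    lyapunov α j z ≤ 10 * (1 + size z) := by
  have hs : (0 : ℝ) ≤ size z := Nat.cast_nonneg _
  unfold lyapunov
  split_ifs
  · unfold coneLyapunov
    have : 0 ≤ 1 / (size z : ℝ) := by positivity
    linarith
  · unfold axisLyapunov glue
    split_ifs
    · refine (axisBound_le hα0 _).trans ?_
      have : ((size z : ℝ) + 2) ^ α ≤ size z + 2 :=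
        Real.rpow_le_self_of_one_le (by linarith) (by linarith)
      linarith
    · linarith

/-! ### Finiteness of all phases and optional stopping for sublinear functions -/

/-- At least `-C (1 + size)`, and at most `o(size)`. -/
def Sublinear (F : ℕ × ℕ → ℝ) : Prop :=
  (∃ C, ∀ z, -(C * (1 + size z)) ≤ F z) ∧ ∀ ε > 0, ∃ K, ∀ z, F z ≤ K + ε * size z

theorem Sublinear.exists_abs_le {F : ℕ × ℕ → ℝ} (hF : Sublinear F) :
    ∃ C, ∀ z, |F z| ≤ C * (1 + size z) := by
  obtain ⟨⟨C, hC⟩, h⟩ := hF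
  obtain ⟨K, hK⟩ := h 1 one_pos
  refine ⟨|C| + |K| + 1, fun z => ?_⟩
  rw [abs_le]
  have h1 := hC z
  have h2 := hK z
  have h3 : (0 : ℝ) ≤ size z := Nat.cast_nonneg _
  have h4 := le_abs_self C
  have h5 := le_abs_self K
  have h6 := abs_nonneg C
  have h7 := abs_nonneg K
  constructor <;> nlinarith

section Chain
variable {Ω : Type*} [MeasurableSpace Ω] {μ : Measure Ω} [IsProbabilityMeasure μ]
  {α : ℝ} {Z : ℕ → Ω → ℕ × ℕ}

/-- Both claims go through one induction: termination of a phase needs a finite mean of the Lyapunov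
function at its start, and the supermartingale bound hands a finite mean size to the next phase. -/
theorem IsAxisWalk.crossing_lt_top_and_lintegral_size_lt_top (hZ : IsAxisWalk μ α Z) (hα0 : 0 ≤ α)
    (hα1 : α ≤ 1 / 2) (j : ℕ) :
    (∀ᵐ ω ∂μ, crossing (fun k => Z k ω) j < ⊤) ∧
      ∫⁻ ω, ENNReal.ofReal (size (phaseStart Z j ω)) ∂μ < ⊤ := by
  induction j with
  | zero =>
    refine ⟨by simp [crossing], ?_⟩
    have : (fun ω => ENNReal.ofReal (size (phaseStart Z 0 ω))) =ᵐ[μ] fun _ => 2 := by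
      filter_upwards [hZ.start] with ω hω
      simp [phaseStart, crossing, hω, size]
    rw [lintegral_congr_ae this]
    simp
  | succ j ih =>
    obtain ⟨hfin, hint⟩ := ih
    choose! g hg0 hg using fun z (hz : z ∈ phaseSet j) =>
      exists_meanStep_lyapunov_le hα0 hα1 hz
    have hH : ∀ z ∈ phaseSet j, step α (fun w => ENNReal.ofReal (lyapunov α j w)) z +
        ENNReal.ofReal (g z) ≤ ENNReal.ofReal (lyapunov α j z) := fun z hz =>
      step_ofReal_add_le hα0 (lyapunov_nonneg α j) (hg0 z hz).le (hg z hz)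
    have hint' : ∫⁻ ω, ENNReal.ofReal (lyapunov α j (phaseStart Z j ω)) ∂μ < ⊤ := by
      calc _ ≤ ∫⁻ ω, ENNReal.ofReal 10 * (1 + ENNReal.ofReal (size (phaseStart Z j ω))) ∂μ := by
            refine lintegral_mono fun ω => ?_
            rw [← ENNReal.ofReal_one, ← ENNReal.ofReal_add (by norm_num) (by positivity),
              ← ENNReal.ofReal_mul (by norm_num)]
            exact ENNReal.ofReal_le_ofReal (lyapunov_le hα0 hα1 j _)
        _ < ⊤ := by
          rw [lintegral_const_mul' _ _ (by simp), lintegral_add_left measurable_const]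
          refine ENNReal.mul_lt_top (by simp) (ENNReal.add_lt_top.2 ⟨by simp, hint⟩)
    have hfin' := hZ.crossing_succ_lt_top hfin hH
      (fun z hz => ENNReal.ofReal_pos.2 (hg0 z hz))
      (fun z => by
        rw [← ENNReal.ofReal_natCast]
        exact ENNReal.ofReal_le_ofReal (size_le_lyapunov α j z)) hint'.ne
    refine ⟨hfin', lt_of_le_of_lt ?_ hint'⟩
    refine le_trans (lintegral_mono fun ω => ?_)
      (hZ.lintegral_phaseStart_succ_le hfin hfin' fun z hz => le_self_add.trans (hH z hz))
    exact ENNReal.ofReal_le_ofReal (size_le_lyapunov α j _)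

theorem IsAxisWalk.crossing_lt_top (hZ : IsAxisWalk μ α Z) (hα0 : 0 ≤ α) (hα1 : α ≤ 1 / 2)
    (j : ℕ) : ∀ᵐ ω ∂μ, crossing (fun k => Z k ω) j < ⊤ :=
  (hZ.crossing_lt_top_and_lintegral_size_lt_top hα0 hα1 j).1

theorem IsAxisWalk.integrable_size (hZ : IsAxisWalk μ α Z) (hα0 : 0 ≤ α) (hα1 : α ≤ 1 / 2)
    (j : ℕ) : Integrable (fun ω => (size (phaseStart Z j ω) : ℝ)) μ := by
  refine ⟨((Measurable.of_discrete (f := fun z => (size z : ℝ))).comp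
    (hZ.measurable_phaseStart j)).aestronglyMeasurable, ?_⟩
  rw [hasFiniteIntegral_iff_ofReal (ae_of_all _ fun ω => by positivity)]
  exact (hZ.crossing_lt_top_and_lintegral_size_lt_top hα0 hα1 j).2

theorem IsAxisWalk.integrable_of_abs_le (hZ : IsAxisWalk μ α Z) (hα0 : 0 ≤ α) (hα1 : α ≤ 1 / 2)
    (j : ℕ) {F : ℕ × ℕ → ℝ} {C : ℝ} (hF : ∀ z, |F z| ≤ C * (1 + size z)) :
    Integrable (fun ω => F (phaseStart Z j ω)) μ := by
  refine Integrable.mono' (((integrable_const (1 : ℝ)).add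
    (hZ.integrable_size hα0 hα1 j)).const_mul C)
    ((Measurable.of_discrete (f := F)).comp (hZ.measurable_phaseStart j)).aestronglyMeasurable ?_
  exact ae_of_all _ fun ω => by simpa using hF _

theorem IsAxisWalk.integrable_of_sublinear (hZ : IsAxisWalk μ α Z) (hα0 : 0 ≤ α)
    (hα1 : α ≤ 1 / 2) (j : ℕ) {F : ℕ × ℕ → ℝ} (hF : Sublinear F) :
    Integrable (fun ω => F (phaseStart Z j ω)) μ :=
  let ⟨_, hC⟩ := hF.exists_abs_le
  hZ.integrable_of_abs_le hα0 hα1 j hC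

/-- The mean of a nonnegative function that decreases in mean during a phase decreases. -/
theorem IsAxisWalk.integral_phaseStart_succ_le (hZ : IsAxisWalk μ α Z) (hα0 : 0 ≤ α)
    (hα1 : α ≤ 1 / 2) (j : ℕ) {F : ℕ × ℕ → ℝ} {C : ℝ} (hF0 : ∀ z, 0 ≤ F z)
    (hF : ∀ z, F z ≤ C * (1 + size z)) (h : ∀ z ∈ phaseSet j, meanStep α F z ≤ F z) :
    ∫ ω, F (phaseStart Z (j + 1) ω) ∂μ ≤ ∫ ω, F (phaseStart Z j ω) ∂μ := by
  have hi : ∀ j, Integrable (fun ω => F (phaseStart Z j ω)) μ := fun j =>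
    hZ.integrable_of_abs_le hα0 hα1 j fun z => by rw [abs_of_nonneg (hF0 z)]; exact hF z
  have h1 := hZ.lintegral_phaseStart_succ_le (hZ.crossing_lt_top hα0 hα1 j)
    (hZ.crossing_lt_top hα0 hα1 (j + 1)) (H := fun z => ENNReal.ofReal (F z)) fun z hz => by
      simpa using step_ofReal_add_le hα0 hF0 (g := 0) (z := z) le_rfl (by simpa using h z hz)
  rw [← ofReal_integral_eq_lintegral_ofReal (hi _) (ae_of_all _ fun ω => hF0 _),
    ← ofReal_integral_eq_lintegral_ofReal (hi _) (ae_of_all _ fun ω => hF0 _)] at h1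
  exact (ENNReal.ofReal_le_ofReal_iff (integral_nonneg fun ω => hF0 _)).1 h1

/-- The mean of a function of sublinear growth that increases in mean during a phase increases. -/
theorem IsAxisWalk.le_integral_phaseStart_succ (hZ : IsAxisWalk μ α Z) (hα0 : 0 ≤ α)
    (hα1 : α ≤ 1 / 2) (j : ℕ) {F : ℕ × ℕ → ℝ} (hFs : Sublinear F)
    (h : ∀ z ∈ phaseSet j, F z ≤ meanStep α F z) :
    ∫ ω, F (phaseStart Z j ω) ∂μ ≤ ∫ ω, F (phaseStart Z (j + 1) ω) ∂μ := by
  have hs : ∀ z, (0 : ℝ) ≤ size z := fun z => Nat.cast_nonneg _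
  have hi := fun j => hZ.integrable_of_sublinear hα0 hα1 j hFs
  obtain ⟨⟨C, hF0⟩, hF⟩ := hFs
  have hV : ∀ j', Integrable (fun ω => lyapunov α j (phaseStart Z j' ω)) μ := fun j' =>
    hZ.integrable_of_abs_le hα0 hα1 j' fun z => by
      rw [abs_of_nonneg (lyapunov_nonneg α j z)]; exact lyapunov_le hα0 hα1 j z
  have key : ∀ ε > 0, ∫ ω, F (phaseStart Z j ω) ∂μ ≤ ∫ ω, F (phaseStart Z (j + 1) ω) ∂μ +
      ε * ∫ ω, lyapunov α j (phaseStart Z j ω) ∂μ := by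
    intro ε hε
    -- Sublinearity makes `K + ε V - F` nonnegative, `V` being the Lyapunov function of the phase.
    -- It is a supermartingale, so the nonnegative case applies; `K` cancels, and `ε` tends to `0`
    -- at the end.
    obtain ⟨K, hK⟩ := hF ε hε
    have h1 := hZ.integral_phaseStart_succ_le hα0 hα1 j
      (F := fun z => K + ε * lyapunov α j z - F z) (C := |K| + ε * 10 + |C|) (fun z => by
        have := mul_le_mul_of_nonneg_left (size_le_lyapunov α j z) hε.le
        linarith [hK z])
      (fun z => by
        have h1 := hF0 z
        have h2 := mul_le_mul_of_nonneg_left (lyapunov_le hα0 hα1 j z) hε.le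
        have h3 := hs z
        have h4 := le_abs_self C
        have h5 := le_abs_self K
        have h7 := abs_nonneg K
        nlinarith)
      (fun z hz => by
        obtain ⟨g, hg0, hg⟩ := exists_meanStep_lyapunov_le hα0 hα1 hz
        rw [meanStep_combination]
        have := mul_le_mul_of_nonneg_left (show meanStep α (lyapunov α j) z ≤ lyapunov α j z by
          linarith) hε.le
        linarith [h z hz])
    have e : ∀ j', ∫ ω, (K + ε * lyapunov α j (phaseStart Z j' ω) - F (phaseStart Z j' ω)) ∂μ =
        K + ε * ∫ ω, lyapunov α j (phaseStart Z j' ω) ∂μ - ∫ ω, F (phaseStart Z j' ω) ∂μ := by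
      intro j'
      have hKV : Integrable (fun ω => K + ε * lyapunov α j (phaseStart Z j' ω)) μ :=
        (integrable_const K).add ((hV j').const_mul ε)
      rw [integral_sub hKV (hi j'),
        integral_add (integrable_const K) ((hV j').const_mul ε), integral_const_mul]
      simp
    rw [e, e] at h1
    have h2 : 0 ≤ ε * ∫ ω, lyapunov α j (phaseStart Z (j + 1) ω) ∂μ :=
      mul_nonneg hε.le (integral_nonneg fun ω => lyapunov_nonneg α j _)
    linarith
  set A := ∫ ω, lyapunov α j (phaseStart Z j ω) ∂μ with hA
  have hA0 : 0 ≤ A := integral_nonneg fun ω => lyapunov_nonneg α j _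
  refine le_of_forall_pos_le_add fun ε hε => ?_
  refine (key (ε / (A + 1)) (by positivity)).trans ?_
  have : ε / (A + 1) * A ≤ ε := by
    rw [div_mul_eq_mul_div, div_le_iff₀ (by positivity)]; nlinarith
  linarith

end Chain

/-! ### Submartingales in the cone -/

/-- The function `φ(x + y) - 4 x y w(x + y)`. -/
noncomputable def corrected (φ w : ℕ → ℝ) (z : ℕ × ℕ) : ℝ :=
  φ (size z) - 4 * (z.1 * z.2 : ℕ) * w (size z)

theorem corrected_of_mem_axes (φ w : ℕ → ℝ) {z : ℕ × ℕ} (hz : z ∈ axes) :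
    corrected φ w z = φ (size z) := by
  have : z.1 * z.2 = 0 := hz
  simp [corrected, this]

/-- With `s = x + y`, the mean of `x y` given a step to size `s ± 1` is `x y ± s / 2`. The drift of
the correction thus involves `s (w(s - 1) - w(s + 1))` and `2 x y` times the second difference of
`w`. As `w` is convex, `4 x y = s ^ 2 - (x - y) ^ 2` reduces the latter to the worst case `x = y`.
-/
theorem corrected_le_meanStep (α : ℝ) {φ w : ℕ → ℝ}
    (hw : ∀ n : ℕ, 2 * w (n + 2) ≤ w (n + 1) + w (n + 3))
    (h : ∀ n : ℕ, φ (n + 2) - (φ (n + 1) + φ (n + 3)) / 2 ≤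
      ((n : ℝ) + 2) * (w (n + 1) - w (n + 3)) -
        ((n : ℝ) + 2) ^ 2 / 2 * (w (n + 1) + w (n + 3) - 2 * w (n + 2)))
    {z : ℕ × ℕ} (hz : z ∈ cone) : corrected φ w z ≤ meanStep α (corrected φ w) z := by
  obtain ⟨i, j, rfl⟩ := exists_of_mem_cone hz
  have h1 := hw (i + j)
  have h2 := h (i + j)
  simp only [meanStep, corrected, size]
  have e1 : i + 2 + (j + 1) = i + j + 3 := by ring
  have e2 : i + (j + 1) = i + j + 1 := by ring
  have e3 : i + 1 + (j + 2) = i + j + 3 := by ring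
  have e4 : i + 1 + j = i + j + 1 := by ring
  have e5 : i + 1 + (j + 1) = i + j + 2 := by ring
  rw [e1, e2, e3, e4, e5]
  push_cast at h2 ⊢
  have h3 := mul_nonneg (sq_nonneg ((i : ℝ) - j)) (sub_nonneg.2 h1)
  nlinarith

/-- Bernoulli's inequality for `1 / t`, inverted. Unlike the tangent, this bounds the power from
below. -/
theorem div_le_rpow {q t : ℝ} (hq0 : 0 ≤ q) (hq1 : q ≤ 1) (ht : 0 < t) :
    t / (t + q * (1 - t)) ≤ t ^ q := by
  have ht' : 0 < 1 / t := by positivity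
  have h := rpow_one_add_le_one_add_mul_self (s := 1 / t - 1) (by linarith) hq0 hq1
  have e : 1 + (1 / t - 1) = t⁻¹ := by rw [one_div]; ring
  have hd : 0 < t + q * (1 - t) := by
    rcases le_total q (1 / 2) with h | h <;> nlinarith
  rw [e, Real.inv_rpow ht.le] at h
  have h2 : 1 + q * (1 / t - 1) = (t + q * (1 - t)) / t := by field_simp
  rw [h2, inv_le_comm₀ (Real.rpow_pos_of_pos ht q) (by positivity), inv_div] at h
  exact h

theorem rpow_sub_average_le {q v : ℝ} (hq0 : 0 ≤ q) (hq1 : q ≤ 1) (hv : 1 < v) :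
    v ^ q - ((v - 1) ^ q + (v + 1) ^ q) / 2 ≤ v ^ (q - 1) / v := by
  have hv0 : 0 < v := by linarith
  set x := 1 / v with hx
  have hx0 : 0 < x := by positivity
  have hx1 : x < 1 := by rw [hx, div_lt_one hv0]; exact hv
  have h1 := div_le_rpow hq0 hq1 (t := 1 + x) (by linarith)
  have h2 := div_le_rpow hq0 hq1 (t := 1 - x) (by linarith)
  have e1 : v + 1 = v * (1 + x) := by rw [hx]; field_simp
  have e2 : v - 1 = v * (1 - x) := by rw [hx]; field_simp
  have e3 : v ^ (q - 1) / v = v ^ q * x ^ 2 := by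
    rw [Real.rpow_sub_one hv0.ne', hx]; field_simp
  rw [e1, e2, e3, Real.mul_rpow hv0.le (by linarith), Real.mul_rpow hv0.le (by linarith)]
  have hsum : 2 * (1 - x ^ 2) ≤ (1 + x) / (1 + x + q * (1 - (1 + x))) +
      (1 - x) / (1 - x + q * (1 - (1 - x))) := by
    have d1 : 0 < 1 + x + q * (1 - (1 + x)) := by nlinarith
    have d2 : 0 < 1 - x + q * (1 - (1 - x)) := by nlinarith
    rw [div_add_div _ _ d1.ne' d2.ne', le_div_iff₀ (by positivity)]
    have e : (1 + x) * (1 - x + q * (1 - (1 - x))) + (1 + x + q * (1 - (1 + x))) * (1 - x) -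
      2 * (1 - x ^ 2) * ((1 + x + q * (1 - (1 + x))) * (1 - x + q * (1 - (1 - x)))) =
      2 * x ^ 2 * (q + (1 - q) ^ 2 * (1 - x ^ 2)) := by ring
    have : 0 ≤ 2 * x ^ 2 * (q + (1 - q) ^ 2 * (1 - x ^ 2)) := by
      have : 0 ≤ 1 - x ^ 2 := by nlinarith
      positivity
    linarith
  have hvq : 0 ≤ v ^ q := by positivity
  nlinarith

/-- Concavity: an increment is at least the slope at its right end. -/
theorem mul_rpow_le_sub {q v : ℝ} (hq0 : 0 ≤ q) (hq1 : q ≤ 1) (hv : 0 ≤ v) :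
    q * (v + 1) ^ (q - 1) ≤ (v + 1) ^ q - v ^ q := by
  have hv1 : 0 < v + 1 := by linarith
  have h1 : 1 / (v + 1) ≤ 1 := by rw [div_le_one hv1]; linarith
  have h := rpow_one_add_le_one_add_mul_self (s := -(1 / (v + 1))) (by linarith) hq0 hq1
  have e : v = (v + 1) * (1 + -(1 / (v + 1))) := by field_simp; ring
  have h2 : v ^ q ≤ (v + 1) ^ q * (1 + q * -(1 / (v + 1))) := by
    nth_rewrite 1 [e]
    rw [Real.mul_rpow hv1.le (by linarith)]
    gcongr
  have e3 : (v + 1) ^ (q - 1) = (v + 1) ^ q * (1 / (v + 1)) := by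
    rw [Real.rpow_sub_one hv1.ne']; ring
  rw [e3]; linarith

/-- The shifted power `(s + A) ^ (1 - α)`. -/
noncomputable def shiftedPow (α A : ℝ) (s : ℕ) : ℝ := ((s : ℝ) + A) ^ (1 - α)

/-- The shifted power, corrected so as to increase in mean inside the cone. -/
noncomputable def correctedPow (α A : ℝ) : ℕ × ℕ → ℝ :=
  corrected (shiftedPow α A) fun s => A ^ (-α) / s

/-- Concavity costs the power at most `A ^ (-α) / s` per step. The choice `w = A ^ (-α) / s` returns
this amount plus the positive rest `A ^ (-α) / ((s - 1) s (s + 1))`. -/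
theorem correctedPow_le_meanStep {α A : ℝ} (hα0 : 0 ≤ α) (hα1 : α ≤ 1) (hA : 1 ≤ A)
    {z : ℕ × ℕ} (hz : z ∈ cone) : correctedPow α A z ≤ meanStep α (correctedPow α A) z := by
  have hD : 0 ≤ A ^ (-α) := by positivity
  refine corrected_le_meanStep α (fun n => ?_) (fun n => ?_) hz
  · push_cast
    rw [← sub_nonneg]
    have : A ^ (-α) / ((n : ℝ) + 1) + A ^ (-α) / (n + 3) - 2 * (A ^ (-α) / (n + 2)) =
      A ^ (-α) * (2 / ((n + 1) * (n + 2) * (n + 3))) := by field_simp; ring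
    rw [this]; positivity
  · set v : ℝ := n + 2 + A with hv
    have hn : (0 : ℝ) ≤ n := n.cast_nonneg
    have h := rpow_sub_average_le (q := 1 - α) (v := v) (by linarith) (by linarith) (by linarith)
    have e1 : ((n + 1 : ℕ) : ℝ) + A = v - 1 := by rw [hv]; push_cast; ring
    have e2 : ((n + 2 : ℕ) : ℝ) + A = v := by rw [hv]; push_cast; ring
    have e3 : ((n + 3 : ℕ) : ℝ) + A = v + 1 := by rw [hv]; push_cast; ring
    simp only [shiftedPow]
    rw [e1, e2, e3]
    refine h.trans ?_
    have h2 : v ^ (1 - α - 1) ≤ A ^ (-α) := by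
      rw [show (1 - α - 1 : ℝ) = -α by ring]
      exact Real.rpow_le_rpow_of_nonpos (by linarith) (by linarith) (by linarith)
    have h3 : v ^ (1 - α - 1) / v ≤ A ^ (-α) / (n + 2) :=
      div_le_div₀ hD h2 (by linarith) (by linarith)
    refine h3.trans ?_
    push_cast
    have : ((n : ℝ) + 2) * (A ^ (-α) / (n + 1) - A ^ (-α) / (n + 3)) -
        (n + 2) ^ 2 / 2 * (A ^ (-α) / (n + 1) + A ^ (-α) / (n + 3) - 2 * (A ^ (-α) / (n + 2))) -
        A ^ (-α) / (n + 2) = A ^ (-α) * (1 / ((n + 1) * (n + 2) * (n + 3))) := by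
      field_simp; ring
    have h4 : 0 ≤ A ^ (-α) * (1 / (((n : ℝ) + 1) * (n + 2) * (n + 3))) := by positivity
    linarith

/-- A concave function, comparable to the logarithm. -/
noncomputable def logLike (A : ℝ) (s : ℕ) : ℝ := Real.log (s + A) + A / (2 * (s + A))

/-- `logLike`, corrected so as to increase in mean inside the cone. -/
noncomputable def correctedLog (A : ℝ) : ℕ × ℕ → ℝ :=
  corrected (logLike A) fun s => 1 / (2 * ((s + A) * (s + A + 1)))

theorem log_sub_average_le {v : ℝ} (hv : 1 < v) :
    Real.log v - (Real.log (v - 1) + Real.log (v + 1)) / 2 ≤ 1 / (2 * ((v - 1) * (v + 1))) := by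
  have h1 : 0 < v - 1 := by linarith
  have h2 : 0 < v + 1 := by linarith
  have h3 : 0 < v := by linarith
  have h := Real.log_le_sub_one_of_pos (show 0 < v * v / ((v - 1) * (v + 1)) by positivity)
  rw [Real.log_div (by positivity) (by positivity), Real.log_mul h3.ne' h3.ne',
    Real.log_mul h1.ne' h2.ne'] at h
  have e : v * v / ((v - 1) * (v + 1)) - 1 = 2 * (1 / (2 * ((v - 1) * (v + 1)))) := by
    field_simp; ring
  linarith

theorem correctedLog_le_meanStep (α : ℝ) {A : ℝ} (hA : 1 ≤ A)
    {z : ℕ × ℕ} (hz : z ∈ cone) : correctedLog A z ≤ meanStep α (correctedLog A) z := by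
  refine corrected_le_meanStep α (fun n => ?_) (fun n => ?_) hz
  all_goals
    have hn : (0 : ℝ) ≤ n := n.cast_nonneg
    set v : ℝ := n + 2 + A with hv
    have e1 : ((n + 1 : ℕ) : ℝ) + A = v - 1 := by rw [hv]; push_cast; ring
    have e2 : ((n + 2 : ℕ) : ℝ) + A = v := by rw [hv]; push_cast; ring
    have e3 : ((n + 3 : ℕ) : ℝ) + A = v + 1 := by rw [hv]; push_cast; ring
    have h1 : 0 < v - 1 := by linarith
    have h3 : 0 < v := by linarith
    try simp only [logLike]
    rw [e1, e2, e3]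
    have hC : 1 / (2 * ((v - 1) * (v - 1 + 1))) + 1 / (2 * ((v + 1) * (v + 1 + 1))) -
        2 * (1 / (2 * (v * (v + 1)))) = 3 / ((v - 1) * v * (v + 1) * (v + 2)) := by
      rw [show v - 1 + 1 = v by ring, show v + 1 + 1 = v + 2 by ring]; field_simp; ring
  · have : 0 ≤ 3 / ((v - 1) * v * (v + 1) * (v + 2)) := by positivity
    linarith
  · have hlog := log_sub_average_le (v := v) (by linarith)
    have hAu : A = v - (n + 2) := by rw [hv]; ring
    -- The convex summand `A / (2 (s + A))` of `logLike` turns the cost of the logarithm into one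
    -- proportional to `n + 2`, the current size, so that the correction can pay for it near the
    -- origin as well.
    have hmain : 1 / (2 * ((v - 1) * (v + 1))) + A / (2 * v) -
        (A / (2 * (v - 1)) + A / (2 * (v + 1))) / 2 = (n + 2) / (2 * ((v - 1) * v * (v + 1))) := by
      rw [hAu]; field_simp; ring
    rw [hC, show v - 1 + 1 = v by ring, show v + 1 + 1 = v + 2 by ring]
    have hr : ((n : ℝ) + 2) * (1 / (2 * ((v - 1) * v)) - 1 / (2 * ((v + 1) * (v + 2)))) -
        (n + 2) ^ 2 / 2 * (3 / ((v - 1) * v * (v + 1) * (v + 2))) -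
        (n + 2) / (2 * ((v - 1) * v * (v + 1))) =
        3 * ((n : ℝ) + 2) * A / (2 * ((v - 1) * v * (v + 1) * (v + 2))) := by
      rw [hAu]; field_simp; ring
    have : 0 ≤ 3 * ((n : ℝ) + 2) * A / (2 * ((v - 1) * v * (v + 1) * (v + 2))) := by positivity
    linarith

/-! ### Submartingales on the axes -/

/-- The mean gain of the shifted power while the walk runs along an axis. -/
noncomputable def axisGain (α A : ℝ) (s : ℕ) : ℝ := 2 * (1 - α) * ((s : ℝ) / (s + 1 + A)) ^ α

theorem axisGain_nonneg {α A : ℝ} (hα1 : α ≤ 1) (hA : 0 ≤ A) (s : ℕ) : 0 ≤ axisGain α A s := by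
  unfold axisGain
  have : 0 ≤ 1 - α := by linarith
  positivity

theorem axisGain_le_succ {α A : ℝ} (hα0 : 0 ≤ α) (hα1 : α ≤ 1) (hA : 0 ≤ A) (s : ℕ) :
    axisGain α A s ≤ axisGain α A (s + 1) := by
  unfold axisGain
  have : 0 ≤ 1 - α := by linarith
  gcongr 2 * (1 - α) * ?_ ^ α
  push_cast
  rw [div_le_div_iff₀ (by positivity) (by positivity)]
  nlinarith

theorem axisGain_le {α A : ℝ} (hα0 : 0 ≤ α) (hA : 0 ≤ A) (s : ℕ) :
    axisGain α A s ≤ 2 := by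
  unfold axisGain
  have h : ((s : ℝ) / (s + 1 + A)) ^ α ≤ 1 :=
    Real.rpow_le_one (by positivity) (by rw [div_le_one (by positivity)]; linarith) hα0
  have : 0 ≤ ((s : ℝ) / (s + 1 + A)) ^ α := by positivity
  nlinarith

/-- The shifted power, modified so as to increase in mean on the axes. -/
noncomputable def axisPow (α A : ℝ) : ℕ × ℕ → ℝ :=
  glue (fun s => shiftedPow α A s + axisGain α A s - 4 * A ^ (-α)) (correctedPow α A)

/-- Exit probability times `axisGain` at `s` is exactly the slope of the shifted power at `s + 1`,
hence at most its increment; monotonicity of the gain does the rest. The constant `4 A ^ (-α)`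
covers the correction at the exit points, where `x y` is less than the size. -/
theorem axisPow_le_meanStep {α A : ℝ} (hα0 : 0 < α) (hα1 : α ≤ 1 / 2) (hA : 1 ≤ A)
    {z : ℕ × ℕ} (hz : z ∈ axes) : axisPow α A z ≤ meanStep α (axisPow α A) z := by
  have hD : 0 ≤ A ^ (-α) := by positivity
  rw [axisPow, glue_of_mem_axes _ _ hz]
  rcases meanStep_glue α (fun s => shiftedPow α A s + axisGain α A s - 4 * A ^ (-α))
    (fun i => shiftedPow α A (i + 1) - 4 * (i : ℕ) * (A ^ (-α) / (i + 1 : ℕ)))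
    (c := correctedPow α A)
    (fun i => by simp [correctedPow, corrected, size, add_comm 1]) hz with ⟨hs, h⟩ | ⟨i, hs, h⟩
  · rw [h, hs]
    have h1 := axisGain_le_succ hα0.le (by linarith) (by linarith : (0 : ℝ) ≤ A) 0
    have h2 : shiftedPow α A 0 ≤ shiftedPow α A 1 := by
      unfold shiftedPow
      refine Real.rpow_le_rpow (by simp; linarith) (by simp) (by linarith)
    linarith
  · rw [h, hs]
    have hp := exitProb_pos α i
    have hp2 := exitProb_le_half hα0.le i
    have h1 := axisGain_le_succ hα0.le (by linarith) (by linarith : (0 : ℝ) ≤ A) (i + 1)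
    have h2 := mul_rpow_le_sub (q := 1 - α) (v := ((i + 1 : ℕ) : ℝ) + A) (by linarith)
      (by linarith) (by positivity)
    have h3 : exitProb α (i + 1) * axisGain α A (i + 1) =
        (1 - α) * (((i + 1 : ℕ) : ℝ) + A + 1) ^ (1 - α - 1) := by
      have hi : 0 < ((i + 1 : ℕ) : ℝ) ^ α := Real.rpow_pos_of_pos (by positivity) _
      have hw : 0 < ((i + 1 : ℕ) : ℝ) + A + 1 := by positivity
      have hw' : 0 < (((i + 1 : ℕ) : ℝ) + A + 1) ^ α := Real.rpow_pos_of_pos hw _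
      rw [axisGain, exitProb, add_right_comm, Real.div_rpow (by positivity) hw.le,
        show (1 - α - 1 : ℝ) = -α by ring, Real.rpow_neg hw.le]
      field_simp
    have e : ((i + 1 + 1 : ℕ) : ℝ) + A = ((i + 1 : ℕ) : ℝ) + A + 1 := by push_cast; ring
    have h4 : 4 * ((i + 1 : ℕ) : ℝ) * (A ^ (-α) / ((i + 1 + 1 : ℕ) : ℝ)) ≤ 4 * A ^ (-α) := by
      rw [mul_div_assoc', div_le_iff₀ (by positivity)]
      push_cast
      nlinarith
    simp only [shiftedPow, e]
    generalize 4 * ((i + 1 : ℕ) : ℝ) * (A ^ (-α) / ((i + 1 + 1 : ℕ) : ℝ)) = c at *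
    have h5 := mul_le_mul_of_nonneg_left h4 hp.le
    have h6 := mul_le_mul_of_nonneg_left h1 (by linarith : 0 ≤ 1 - exitProb α (i + 1))
    have h7 : i + 1 + 1 = i + 2 := rfl
    rw [h7] at h6
    rw [← h3] at h2
    nlinarith

/-- The shifted power of the dominant coordinate, to be used when the walk leaves an axis. -/
noncomputable def domPow (α A : ℝ) : ℕ × ℕ → ℝ :=
  glue (shiftedPow α A) fun z => shiftedPow α A (dom z + 1)

theorem shiftedPow_mono {α A : ℝ} (hα1 : α ≤ 1) (hA : 0 ≤ A) : Monotone (shiftedPow α A) := by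
  intro s t hst
  unfold shiftedPow
  exact Real.rpow_le_rpow (by positivity) (by gcongr) (by linarith)

theorem domPow_le_meanStep {α A : ℝ} (hα1 : α ≤ 1) (hA : 0 ≤ A)
    {z : ℕ × ℕ} (hz : z ∈ axes) : domPow α A z ≤ meanStep α (domPow α A) z := by
  rw [domPow, glue_of_mem_axes _ _ hz]
  rcases meanStep_glue α (shiftedPow α A) (fun i => shiftedPow α A (i + 1))
    (c := fun z => shiftedPow α A (dom z + 1))
    (fun i => by simp [dom]) hz with ⟨hs, h⟩ | ⟨i, hs, h⟩
  · rw [h, hs]; exact shiftedPow_mono hα1 hA (Nat.zero_le 1)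
  · rw [h, hs]
    have := shiftedPow_mono hα1 hA (Nat.le_succ (i + 1))
    linarith

/-- The gain of `logLike` while the walk runs along an axis. -/
noncomputable def logGain (A : ℝ) (s : ℕ) : ℝ := 1 / (4 * (s + 1 + A))

/-- `logLike`, modified so as to increase in mean on the axes. -/
noncomputable def axisLog (A : ℝ) : ℕ × ℕ → ℝ :=
  glue (fun s => logLike A s + logGain A s) (correctedLog A)

/-- The decreasing summand `A / (2 (s + A))` eats at most half of the increment of the logarithm. -/
theorem le_logLike_sub {A : ℝ} (hA : 1 ≤ A) (s : ℕ) :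
    1 / (2 * (s + 1 + A)) ≤ logLike A (s + 1) - logLike A s := by
  have hs : (0 : ℝ) ≤ s := s.cast_nonneg
  set v : ℝ := s + A with hv
  have hv0 : 0 < v := by linarith
  have e : ((s + 1 : ℕ) : ℝ) + A = v + 1 := by rw [hv]; push_cast; ring
  have h := Real.log_le_sub_one_of_pos (show 0 < v / (v + 1) by positivity)
  rw [Real.log_div (by positivity) (by positivity)] at h
  simp only [logLike]
  rw [e, ← hv, show (s : ℝ) + 1 + A = v + 1 by rw [hv]; ring]
  have h2 : v / (v + 1) - 1 = -(1 / (v + 1)) := by field_simp; ring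
  have h3 : A / (2 * v) - A / (2 * (v + 1)) = (A / v) * (1 / (2 * (v + 1))) := by field_simp; ring
  have h4 : A / v ≤ 1 := by rw [div_le_one hv0]; linarith
  have h5 : (A / v) * (1 / (2 * (v + 1))) ≤ 1 * (1 / (2 * (v + 1))) := by gcongr
  have h6 : 1 / (v + 1) = 2 * (1 / (2 * (v + 1))) := by field_simp
  linarith

/-- The increment of `logLike` is at least twice `logGain`. One half is kept as gain, the other pays
the correction at the exit point, which the condition on `A` makes small enough. -/
theorem axisLog_le_meanStep {α A : ℝ} (hα0 : 0 ≤ α) (hA : 1 ≤ A)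
    (hA' : ∀ i : ℕ, ((i + 1 : ℕ) : ℝ) ^ (1 - α) ≤ (((i + 1 : ℕ) : ℝ) + A + 2) / 4)
    {z : ℕ × ℕ} (hz : z ∈ axes) : axisLog A z ≤ meanStep α (axisLog A) z := by
  rw [axisLog, glue_of_mem_axes _ _ hz]
  have hpos : ∀ s, 0 ≤ logGain A s := fun s => by unfold logGain; positivity
  have hdouble : ∀ s : ℕ, 1 / (2 * ((s : ℝ) + 1 + A)) = 2 * logGain A s := fun s => by
    unfold logGain; field_simp; norm_num
  rcases meanStep_glue α (fun s => logLike A s + logGain A s)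
    (fun i => logLike A (i + 1) - 4 * (i : ℕ) *
      (1 / (2 * (((i + 1 : ℕ) + A) * ((i + 1 : ℕ) + A + 1)))))
    (c := correctedLog A)
    (fun i => by simp [correctedLog, corrected, size, add_comm 1]) hz with ⟨hs, h⟩ | ⟨i, hs, h⟩
  · rw [h, hs]
    have h1 := le_logLike_sub hA 0
    rw [hdouble] at h1
    linarith [hpos 1, hpos 0]
  · rw [h, hs]
    have h1 := le_logLike_sub hA (i + 1)
    rw [hdouble] at h1
    have hp := exitProb_pos α i
    have hp2 := exitProb_le_half hα0 i
    have hloss : exitProb α (i + 1) * (4 * ((i + 1 : ℕ) : ℝ) *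
        (1 / (2 * (((i + 1 + 1 : ℕ) + A) * ((i + 1 + 1 : ℕ) + A + 1))))) ≤ logGain A (i + 1) := by
      have hi : 0 < ((i + 1 : ℕ) : ℝ) := by positivity
      have hia : 0 < ((i + 1 : ℕ) : ℝ) ^ α := Real.rpow_pos_of_pos hi _
      have e1 : ((i + 1 + 1 : ℕ) : ℝ) = ((i + 1 : ℕ) : ℝ) + 1 := by push_cast; ring
      have e2 : ((i + 1 : ℕ) : ℝ) ^ (1 - α) = ((i + 1 : ℕ) : ℝ) / ((i + 1 : ℕ) : ℝ) ^ α := by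
        rw [Real.rpow_sub hi, Real.rpow_one]
      have h2 := hA' i
      rw [e2] at h2
      rw [exitProb, logGain, e1]
      set x := ((i + 1 : ℕ) : ℝ) with hx
      calc 1 / (2 * x ^ α) * (4 * x * (1 / (2 * ((x + 1 + A) * (x + 1 + A + 1)))))
          = x / x ^ α * (1 / ((x + 1 + A) * (x + A + 2))) := by
            rw [show x + 1 + A + 1 = x + A + 2 by ring]; field_simp; norm_num
        _ ≤ (x + A + 2) / 4 * (1 / ((x + 1 + A) * (x + A + 2))) := by gcongr
        _ = _ := by field_simp
    have h3 := mul_nonneg (by linarith : 0 ≤ 1 - exitProb α (i + 1)) (hpos (i + 2))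
    have h4 : i + 1 + 1 = i + 2 := rfl
    rw [h4] at hloss h1 ⊢
    nlinarith

/-- Weighted arithmetic-geometric means; the second point is chosen so that its power `α` cancels
the factor `4 ^ (1 - α)`. -/
theorem exists_rpow_le_div_four {α : ℝ} (hα0 : 0 < α) (hα1 : α < 1) :
    ∃ A : ℝ, 1 ≤ A ∧ ∀ x : ℝ, 0 ≤ x → x ^ (1 - α) ≤ (x + A + 2) / 4 := by
  have h4 : (0 : ℝ) ≤ 4 ^ ((1 - α) / α) := by positivity
  refine ⟨4 * 4 ^ ((1 - α) / α) + 1, by linarith, fun x hx => ?_⟩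
  have h := Real.geom_mean_le_arith_mean2_weighted (w₁ := 1 - α) (w₂ := α) (p₁ := x / 4)
    (p₂ := 4 ^ ((1 - α) / α)) (by linarith) hα0.le (by positivity) (by positivity) (by ring)
  rw [Real.div_rpow hx (by norm_num), ← Real.rpow_mul (by norm_num),
    div_mul_cancel₀ _ hα0.ne', div_mul_cancel₀ _ (by positivity)] at h
  nlinarith

/-! ### Growth of the test functions -/

theorem sublinear_of_nonneg {F : ℕ × ℕ → ℝ} (h0 : ∀ z, 0 ≤ F z)
    (h : ∀ ε > 0, ∃ K, ∀ z, F z ≤ K + ε * size z) : Sublinear F :=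
  ⟨⟨0, fun z => by simpa using h0 z⟩, h⟩

theorem Sublinear.add {F G : ℕ × ℕ → ℝ} (hF : Sublinear F) (hG : Sublinear G) :
    Sublinear fun z => F z + G z := by
  obtain ⟨⟨C, hC⟩, hF⟩ := hF
  obtain ⟨⟨D, hD⟩, hG⟩ := hG
  refine ⟨⟨C + D, fun z => by linarith [hC z, hD z]⟩, fun ε hε => ?_⟩
  obtain ⟨K, hK⟩ := hF (ε / 2) (by positivity)
  obtain ⟨L, hL⟩ := hG (ε / 2) (by positivity)
  exact ⟨K + L, fun z => by linarith [hK z, hL z]⟩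

theorem Sublinear.sub_of_nonneg {F G : ℕ × ℕ → ℝ} (hF : Sublinear F) (h0 : ∀ z, 0 ≤ G z) {C : ℝ}
    (hG : ∀ z, G z ≤ C * (1 + size z)) : Sublinear fun z => F z - G z := by
  obtain ⟨⟨D, hD⟩, hF⟩ := hF
  refine ⟨⟨D + C, fun z => by linarith [hD z, hG z]⟩, fun ε hε => ?_⟩
  obtain ⟨K, hK⟩ := hF ε hε
  exact ⟨K, fun z => by linarith [hK z, h0 z]⟩

theorem sublinear_of_nonneg_of_le {F : ℕ × ℕ → ℝ} (h0 : ∀ z, 0 ≤ F z) {K : ℝ}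
    (h : ∀ z, F z ≤ K) : Sublinear F :=
  sublinear_of_nonneg h0 fun ε hε => ⟨K, fun z => by
    have : 0 ≤ ε * size z := by positivity
    linarith [h z]⟩

theorem Sublinear.glue {l : ℕ → ℝ} {c : ℕ × ℕ → ℝ} (hl : Sublinear fun z => l (size z))
    (hc : Sublinear c) : Sublinear (glue l c) := by
  obtain ⟨⟨C, hC⟩, hl⟩ := hl
  obtain ⟨⟨D, hD⟩, hc⟩ := hc
  refine ⟨⟨max C D, fun z => ?_⟩, fun ε hε => ?_⟩
  · have h1 : (0 : ℝ) ≤ 1 + size z := by positivity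
    have h2 := mul_le_mul_of_nonneg_right (le_max_left C D) h1
    have h3 := mul_le_mul_of_nonneg_right (le_max_right C D) h1
    unfold AxisWalk.glue
    split_ifs
    · linarith [hC z]
    · linarith [hD z]
  · obtain ⟨K, hK⟩ := hl ε hε
    obtain ⟨L, hL⟩ := hc ε hε
    refine ⟨max K L, fun z => ?_⟩
    unfold AxisWalk.glue
    split_ifs
    · linarith [hK z, le_max_left K L]
    · linarith [hL z, le_max_right K L]

/-- Young's inequality for `ε t` and a power of `ε` that removes the factor `ε ^ (1 - α)`. -/
theorem exists_rpow_le {α : ℝ} (hα0 : 0 < α) (hα1 : α < 1) {ε : ℝ} (hε : 0 < ε) :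
    ∃ K, ∀ t : ℝ, 0 ≤ t → t ^ (1 - α) ≤ K + ε * t := by
  refine ⟨α * (ε ^ (-((1 - α) / α))), fun t ht => ?_⟩
  have h := Real.geom_mean_le_arith_mean2_weighted (w₁ := 1 - α) (w₂ := α) (p₁ := ε * t)
    (p₂ := ε ^ (-((1 - α) / α))) (by linarith) hα0.le (by positivity) (by positivity) (by ring)
  have e : -((1 - α) / α) * α = -(1 - α) := by field_simp
  rw [Real.mul_rpow hε.le ht, ← Real.rpow_mul hε.le, e, Real.rpow_neg hε.le] at h
  have h2 : 0 < ε ^ (1 - α) := Real.rpow_pos_of_pos hε _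
  have h3 : ε ^ (1 - α) * t ^ (1 - α) * (ε ^ (1 - α))⁻¹ = t ^ (1 - α) := by field_simp
  rw [h3] at h
  have : 0 ≤ α * (ε * t) := by positivity
  linarith

theorem sublinear_shiftedPow {α A : ℝ} (hα0 : 0 < α) (hα1 : α < 1) (hA : 0 ≤ A)
    {f : ℕ × ℕ → ℕ} (hf : ∀ z, f z ≤ size z + 1) :
    Sublinear fun z => shiftedPow α A (f z) := by
  refine sublinear_of_nonneg (fun z => by unfold shiftedPow; positivity) fun ε hε => ?_
  obtain ⟨K, hK⟩ := exists_rpow_le hα0 hα1 hε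
  refine ⟨K + ε * (A + 1), fun z => ?_⟩
  have h1 := hK ((f z : ℝ) + A) (by positivity)
  have h2 : (f z : ℝ) ≤ size z + 1 := by exact_mod_cast hf z
  have h3 := mul_le_mul_of_nonneg_left h2 hε.le
  unfold shiftedPow
  linarith

theorem sublinear_correctedPow {α A : ℝ} (hα0 : 0 < α) (hα1 : α < 1) (hA : 0 ≤ A) :
    Sublinear (correctedPow α A) := by
  have hD : 0 ≤ A ^ (-α) := by positivity
  refine (sublinear_shiftedPow hα0 hα1 hA (f := size) fun z => by omega).sub_of_nonneg
    (C := 4 * A ^ (-α)) (fun z => by positivity) fun z => ?_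
  rcases Nat.eq_zero_or_pos (size z) with h | h
  · have h1 : z.1 * z.2 = 0 := by
      have : z.1 = 0 := by unfold size at h; omega
      simp [this]
    rw [h1]; simp; positivity
  · have h1 : (0 : ℝ) < size z := by exact_mod_cast h
    have h2 : ((z.1 * z.2 : ℕ) : ℝ) ≤ size z * size z := by
      unfold size; push_cast; nlinarith [mul_nonneg (Nat.cast_nonneg (α := ℝ) z.1) (Nat.cast_nonneg (α := ℝ) z.2), sq_nonneg (z.1 : ℝ), sq_nonneg (z.2 : ℝ)]
    rw [mul_div_assoc', div_le_iff₀ h1]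
    nlinarith

theorem logLike_nonneg {A : ℝ} (hA : 1 ≤ A) (s : ℕ) : 0 ≤ logLike A s := by
  have h : 1 ≤ (s : ℝ) + A := by linarith [s.cast_nonneg (α := ℝ)]
  have := Real.log_nonneg h
  unfold logLike
  positivity

theorem logLike_le {A : ℝ} (hA : 1 ≤ A) (s : ℕ) {ε : ℝ} (hε : 0 < ε) :
    logLike A s ≤ ε * (s + A) - Real.log ε := by
  have h : 1 ≤ (s : ℝ) + A := by linarith [s.cast_nonneg (α := ℝ)]
  have h1 := Real.log_le_sub_one_of_pos (show 0 < ε * ((s : ℝ) + A) by positivity)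
  rw [Real.log_mul hε.ne' (by positivity)] at h1
  have h2 : A / (2 * (s + A)) ≤ 1 := by
    rw [div_le_one (by positivity)]; linarith [s.cast_nonneg (α := ℝ)]
  unfold logLike
  linarith

theorem sublinear_logLike {A : ℝ} (hA : 1 ≤ A) : Sublinear fun z => logLike A (size z) :=
  sublinear_of_nonneg (fun z => logLike_nonneg hA _) fun ε hε =>
    ⟨ε * A - Real.log ε, fun z => by linarith [logLike_le hA (size z) hε]⟩

theorem correctedLog_loss_le {A : ℝ} (hA : 1 ≤ A) (z : ℕ × ℕ) :
    4 * ((z.1 * z.2 : ℕ) : ℝ) * (1 / (2 * ((size z + A) * (size z + A + 1)))) ≤ 2 := by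
  have h : 1 ≤ (size z : ℝ) + A := by linarith [(size z).cast_nonneg (α := ℝ)]
  rw [mul_one_div, div_le_iff₀ (by positivity)]
  unfold size
  push_cast
  nlinarith [mul_nonneg (Nat.cast_nonneg (α := ℝ) z.1) (Nat.cast_nonneg (α := ℝ) z.2),
    Nat.cast_nonneg (α := ℝ) z.1, Nat.cast_nonneg (α := ℝ) z.2, sq_nonneg (z.1 : ℝ),
    sq_nonneg (z.2 : ℝ)]

theorem sublinear_correctedLog {A : ℝ} (hA : 1 ≤ A) : Sublinear (correctedLog A) := by
  refine (sublinear_logLike hA).sub_of_nonneg (C := 2) (fun z => by positivity) fun z => ?_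
  have := correctedLog_loss_le hA z
  linarith [(size z).cast_nonneg (α := ℝ)]

theorem logGain_nonneg {A : ℝ} (hA : 1 ≤ A) (s : ℕ) : 0 ≤ logGain A s := by
  unfold logGain; positivity

theorem logGain_le {A : ℝ} (hA : 1 ≤ A) (s : ℕ) : logGain A s ≤ 1 := by
  unfold logGain
  rw [div_le_one (by positivity)]
  linarith [s.cast_nonneg (α := ℝ)]

theorem sublinear_logGain {A : ℝ} (hA : 1 ≤ A) : Sublinear fun z => logGain A (size z) :=
  sublinear_of_nonneg_of_le (fun _ => logGain_nonneg hA _) fun _ => logGain_le hA _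

theorem sublinear_axisGain {α A : ℝ} (hα0 : 0 < α) (hα1 : α < 1) (hA : 0 ≤ A) :
    Sublinear fun z => axisGain α A (size z) :=
  sublinear_of_nonneg_of_le (fun _ => axisGain_nonneg hα1.le hA _)
    fun _ => axisGain_le hα0.le hA _

theorem dom_le_size (z : ℕ × ℕ) : dom z ≤ size z := by
  unfold dom size; omega

/-! ### Inequalities for the means over one cycle -/

section Chain
variable {Ω : Type*} [MeasurableSpace Ω] {μ : Measure Ω} [IsProbabilityMeasure μ]
  {α : ℝ} {Z : ℕ → Ω → ℕ × ℕ}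

theorem IsAxisWalk.ae_phaseStart_odd (hZ : IsAxisWalk μ α Z) (hα0 : 0 ≤ α) (hα1 : α ≤ 1 / 2)
    (n : ℕ) : ∀ᵐ ω ∂μ, phaseStart Z (2 * n + 1) ω ∈ axes := by
  simpa only [phaseSet_odd] using hZ.ae_phaseStart_mem (hZ.crossing_lt_top hα0 hα1 (2 * n + 1))

theorem IsAxisWalk.ae_phaseStart_even (hZ : IsAxisWalk μ α Z) (hα0 : 0 ≤ α) (hα1 : α ≤ 1 / 2)
    (n : ℕ) : ∀ᵐ ω ∂μ, phaseStart Z (2 * n) ω ∈ cone := by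
  simpa only [phaseSet_even] using hZ.ae_phaseStart_mem (hZ.crossing_lt_top hα0 hα1 (2 * n))

/-- The correction vanishes on the axes, so only its value at the start of the excursion is left. -/
theorem IsAxisWalk.integral_corrected_le (hZ : IsAxisWalk μ α Z) (hα0 : 0 ≤ α) (hα1 : α ≤ 1 / 2)
    (n : ℕ) {φ w : ℕ → ℝ} (hs : Sublinear (corrected φ w))
    (h : ∀ z ∈ cone, corrected φ w z ≤ meanStep α (corrected φ w) z) :
    ∫ ω, corrected φ w (phaseStart Z (2 * n) ω) ∂μ ≤
      ∫ ω, φ (size (phaseStart Z (2 * n + 1) ω)) ∂μ := by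
  refine (hZ.le_integral_phaseStart_succ hα0 hα1 (2 * n) hs (by rwa [phaseSet_even])).trans
    (le_of_eq (integral_congr_ae ?_))
  filter_upwards [hZ.ae_phaseStart_odd hα0 hα1 n] with ω hω
  exact corrected_of_mem_axes φ w hω

theorem IsAxisWalk.integral_le_glue (hZ : IsAxisWalk μ α Z) (hα0 : 0 ≤ α) (hα1 : α ≤ 1 / 2)
    (n : ℕ) {l : ℕ → ℝ} {c : ℕ × ℕ → ℝ} (hs : Sublinear (glue l c))
    (h : ∀ z ∈ axes, glue l c z ≤ meanStep α (glue l c) z) :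
    ∫ ω, l (size (phaseStart Z (2 * n + 1) ω)) ∂μ ≤
      ∫ ω, c (phaseStart Z (2 * (n + 1)) ω) ∂μ := by
  have h1 := hZ.le_integral_phaseStart_succ hα0 hα1 (2 * n + 1) hs (by rwa [phaseSet_odd])
  have e1 : ∫ ω, l (size (phaseStart Z (2 * n + 1) ω)) ∂μ =
      ∫ ω, glue l c (phaseStart Z (2 * n + 1) ω) ∂μ := by
    refine integral_congr_ae ?_
    filter_upwards [hZ.ae_phaseStart_odd hα0 hα1 n] with ω hω
    exact (glue_of_mem_axes l c hω).symm
  have e2 : ∫ ω, c (phaseStart Z (2 * (n + 1)) ω) ∂μ =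
      ∫ ω, glue l c (phaseStart Z (2 * n + 1 + 1) ω) ∂μ := by
    refine integral_congr_ae ?_
    filter_upwards [hZ.ae_phaseStart_even hα0 hα1 (n + 1)] with ω hω
    exact (glue_of_mem_cone l c hω).symm
  rw [e1, e2]
  exact h1

theorem IsAxisWalk.integral_shiftedPow_add_le (hZ : IsAxisWalk μ α Z) (hα0 : 0 < α)
    (hα1 : α ≤ 1 / 2) {A : ℝ} (hA : 1 ≤ A) (n : ℕ) :
    ∫ ω, shiftedPow α A (size (phaseStart Z (2 * n + 1) ω)) ∂μ +
      ∫ ω, axisGain α A (size (phaseStart Z (2 * n + 1) ω)) ∂μ - 4 * A ^ (-α) ≤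
      ∫ ω, shiftedPow α A (size (phaseStart Z (2 * (n + 1) + 1) ω)) ∂μ := by
  have hA0 : 0 ≤ A := by linarith
  have hα1' : α < 1 := by linarith
  have hsp := sublinear_shiftedPow hα0 hα1' hA0 (f := size) fun z => by omega
  have hsg := sublinear_axisGain hα0 hα1' hA0
  have h1 := hZ.integral_le_glue hα0.le hα1 n
    (l := fun s => shiftedPow α A s + axisGain α A s - 4 * A ^ (-α)) (c := correctedPow α A)
    (((hsp.add hsg).sub_of_nonneg (G := fun _ => 4 * A ^ (-α)) (C := 4 * A ^ (-α))
      (fun z => by positivity) (fun z => by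
        have : 0 ≤ 4 * A ^ (-α) * size z := by positivity
        linarith)).glue (sublinear_correctedPow hα0 hα1' hA0))
    (fun z hz => axisPow_le_meanStep hα0 hα1 hA hz)
  have h2 := hZ.integral_corrected_le hα0.le hα1 (n + 1) (sublinear_correctedPow hα0 hα1' hA0)
    (fun z hz => correctedPow_le_meanStep hα0.le hα1'.le hA hz)
  have i1 := hZ.integrable_of_sublinear hα0.le hα1 (2 * n + 1) hsp
  have i2 := hZ.integrable_of_sublinear hα0.le hα1 (2 * n + 1) hsg
  have i3 : Integrable (fun ω => shiftedPow α A (size (phaseStart Z (2 * n + 1) ω)) +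
    axisGain α A (size (phaseStart Z (2 * n + 1) ω))) μ := i1.add i2
  rw [integral_sub i3 (integrable_const _), integral_add i1 i2] at h1
  simp only [integral_const, probReal_univ, one_smul] at h1
  exact h1.trans h2

/-- Along an axis the walk only moves outwards. This passes from the size at arrival to the dominant
coordinate at departure. -/
theorem IsAxisWalk.integral_shiftedPow_le_dom (hZ : IsAxisWalk μ α Z) (hα0 : 0 < α)
    (hα1 : α ≤ 1 / 2) {A : ℝ} (hA : 0 ≤ A) (n : ℕ) :
    ∫ ω, shiftedPow α A (size (phaseStart Z (2 * n + 1) ω)) ∂μ ≤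
      ∫ ω, shiftedPow α A (dom (phaseStart Z (2 * (n + 1)) ω) + 1) ∂μ :=
  hZ.integral_le_glue hα0.le hα1 n (l := shiftedPow α A)
    (c := fun z => shiftedPow α A (dom z + 1))
    ((sublinear_shiftedPow hα0 (by linarith) hA fun z => by omega).glue
      (sublinear_shiftedPow hα0 (by linarith) hA fun z => by
        have := dom_le_size z
        omega))
    fun z hz => domPow_le_meanStep (by linarith) hA hz

theorem IsAxisWalk.integral_logLike_add_le (hZ : IsAxisWalk μ α Z) (hα0 : 0 < α)
    (hα1 : α ≤ 1 / 2) {A : ℝ} (hA : 1 ≤ A)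
    (hA' : ∀ x : ℝ, 0 ≤ x → x ^ (1 - α) ≤ (x + A + 2) / 4) (n : ℕ) :
    ∫ ω, logLike A (size (phaseStart Z (2 * n + 1) ω)) ∂μ +
      ∫ ω, logGain A (size (phaseStart Z (2 * n + 1) ω)) ∂μ ≤
      ∫ ω, logLike A (size (phaseStart Z (2 * (n + 1) + 1) ω)) ∂μ := by
  have h1 := hZ.integral_le_glue hα0.le hα1 n
    (l := fun s => logLike A s + logGain A s) (c := correctedLog A)
    (((sublinear_logLike hA).add (sublinear_logGain hA)).glue (sublinear_correctedLog hA))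
    (fun z hz => axisLog_le_meanStep hα0.le hA (fun i => hA' _ (by positivity)) hz)
  have h2 := hZ.integral_corrected_le hα0.le hα1 (n + 1) (sublinear_correctedLog hA)
    (fun z hz => correctedLog_le_meanStep α hA hz)
  have i1 := hZ.integrable_of_sublinear hα0.le hα1 (2 * n + 1) (sublinear_logLike hA)
  have i2 := hZ.integrable_of_sublinear hα0.le hα1 (2 * n + 1) (sublinear_logGain hA)
  rw [integral_add i1 i2] at h1
  exact h1.trans h2

theorem meanStep_size (α : ℝ) {z : ℕ × ℕ} (hz : z ∈ cone) :
    meanStep α (fun z => (size z : ℝ)) z = size z := by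
  obtain ⟨i, j, rfl⟩ := exists_of_mem_cone hz
  simp only [meanStep, size]
  push_cast
  ring

theorem IsAxisWalk.integral_size_odd_le (hZ : IsAxisWalk μ α Z) (hα0 : 0 ≤ α)
    (hα1 : α ≤ 1 / 2) (n : ℕ) :
    ∫ ω, (size (phaseStart Z (2 * n + 1) ω) : ℝ) ∂μ ≤ ∫ ω, (size (phaseStart Z (2 * n) ω) : ℝ) ∂μ :=
  hZ.integral_phaseStart_succ_le hα0 hα1 (2 * n) (F := fun z => (size z : ℝ)) (C := 1)
    (fun z => by positivity) (fun z => by linarith)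
    (fun z hz => (meanStep_size α (by rwa [phaseSet_even] at hz)).le)

/-- The Lyapunov function of the axes bounds the mean size at exit by the arrival point; Jensen's
inequality for `t ^ α` closes the recursion in the mean alone. -/
theorem IsAxisWalk.integral_size_even_succ_le (hZ : IsAxisWalk μ α Z) (hα0 : 0 ≤ α)
    (hα1 : α ≤ 1 / 2) (n : ℕ) :
    ∫ ω, (size (phaseStart Z (2 * (n + 1)) ω) : ℝ) ∂μ ≤
      ∫ ω, (size (phaseStart Z (2 * n) ω) : ℝ) ∂μ + 6 +
        2 * (∫ ω, (size (phaseStart Z (2 * n) ω) : ℝ) ∂μ + 2) ^ α := by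
  have hodd := hZ.integral_size_odd_le hα0 hα1 n
  have hi := hZ.integrable_size hα0 hα1
  have hL : ∀ j, Integrable (fun ω => lyapunov α (2 * n + 1) (phaseStart Z j ω)) μ := fun j =>
    hZ.integrable_of_abs_le hα0 hα1 j fun z => by
      rw [abs_of_nonneg (lyapunov_nonneg _ _ z)]; exact lyapunov_le hα0 hα1 _ z
  have h1 : ∫ ω, (size (phaseStart Z (2 * (n + 1)) ω) : ℝ) ∂μ ≤
      ∫ ω, lyapunov α (2 * n + 1) (phaseStart Z (2 * n + 1 + 1) ω) ∂μ :=
    integral_mono (hi _) (hL _) fun ω => size_le_lyapunov _ _ _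
  have h2 := hZ.integral_phaseStart_succ_le hα0 hα1 (2 * n + 1) (lyapunov_nonneg α (2 * n + 1))
    (lyapunov_le hα0 hα1 (2 * n + 1)) fun z hz => by
      obtain ⟨g, hg0, hg⟩ := exists_meanStep_lyapunov_le hα0 hα1 hz
      linarith
  have hi2 : Integrable (fun ω => (size (phaseStart Z (2 * n + 1) ω) : ℝ) + 2) μ :=
    (hi _).add (integrable_const _)
  have hip : Integrable (fun ω => ((size (phaseStart Z (2 * n + 1) ω) : ℝ) + 2) ^ α) μ :=
    hZ.integrable_of_abs_le hα0 hα1 (2 * n + 1) (F := fun z => ((size z : ℝ) + 2) ^ α) (C := 2)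
      fun z => by
        rw [abs_of_nonneg (by positivity)]
        have := Real.rpow_le_self_of_one_le (x := (size z : ℝ) + 2) (y := α)
          (by linarith [(size z).cast_nonneg (α := ℝ)]) (by linarith)
        linarith [(size z).cast_nonneg (α := ℝ)]
  have hi6 : Integrable (fun ω => (size (phaseStart Z (2 * n + 1) ω) : ℝ) + 6) μ :=
    (hi _).add (integrable_const _)
  have h3 : ∫ ω, lyapunov α (2 * n + 1) (phaseStart Z (2 * n + 1) ω) ∂μ ≤
      ∫ ω, ((size (phaseStart Z (2 * n + 1) ω) : ℝ) + 6 +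
        2 * ((size (phaseStart Z (2 * n + 1) ω) : ℝ) + 2) ^ α) ∂μ := by
    refine integral_mono_ae (hL _) (hi6.add (hip.const_mul 2)) ?_
    filter_upwards [hZ.ae_phaseStart_odd hα0 hα1 n] with ω hω
    have : lyapunov α (2 * n + 1) = axisLyapunov α := if_neg (by simp)
    rw [this, axisLyapunov, glue_of_mem_axes _ _ hω]
    exact axisBound_le hα0 _
  rw [integral_add hi6 (hip.const_mul 2), integral_const_mul,
    integral_add (hi _) (integrable_const _)] at h3
  have hJ : ∫ ω, ((size (phaseStart Z (2 * n + 1) ω) : ℝ) + 2) ^ α ∂μ ≤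
      (∫ ω, ((size (phaseStart Z (2 * n + 1) ω) : ℝ) + 2) ∂μ) ^ α :=
    (Real.concaveOn_rpow hα0 (by linarith)).le_map_integral
      (Real.continuous_rpow_const hα0).continuousOn isClosed_Ici
      (ae_of_all _ fun ω => by simp; positivity) hi2 hip
  rw [integral_add (hi _) (integrable_const _)] at hJ
  simp only [integral_const, probReal_univ, one_smul] at h3 hJ
  have hJ2 : (∫ ω, (size (phaseStart Z (2 * n + 1) ω) : ℝ) ∂μ + 2) ^ α ≤
      (∫ ω, (size (phaseStart Z (2 * n) ω) : ℝ) ∂μ + 2) ^ α := by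
    have : 0 ≤ ∫ ω, (size (phaseStart Z (2 * n + 1) ω) : ℝ) ∂μ :=
      integral_nonneg fun ω => by positivity
    exact Real.rpow_le_rpow (by positivity) (by linarith) hα0
  linarith

end Chain

/-! ### Convergence in probability from two moments -/

/-- The gap in Bernoulli's inequality. -/
noncomputable def bernoulliGap (q t : ℝ) : ℝ := 1 + q * (t - 1) - t ^ q

theorem bernoulliGap_nonneg {q t : ℝ} (hq0 : 0 ≤ q) (hq1 : q ≤ 1) (ht : 0 ≤ t) :
    0 ≤ bernoulliGap q t := by
  have := rpow_one_add_le_one_add_mul_self (s := t - 1) (by linarith) hq0 hq1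
  rw [add_sub_cancel] at this
  unfold bernoulliGap; linarith

theorem bernoulliGap_pos {q t : ℝ} (hq0 : 0 < q) (hq1 : q < 1) (ht : 0 ≤ t) (ht1 : t ≠ 1) :
    0 < bernoulliGap q t := by
  have := rpow_one_add_lt_one_add_mul_self (s := t - 1) (by linarith) (sub_ne_zero.2 ht1) hq0 hq1
  rw [add_sub_cancel] at this
  unfold bernoulliGap; linarith

/-- The gap is convex, nonnegative and zero at `1`, so it grows along each ray from `1`. -/
theorem bernoulliGap_le {q s t l : ℝ} (hq0 : 0 ≤ q) (hq1 : q ≤ 1) (ht : 0 ≤ t) (hl0 : 0 ≤ l)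
    (hl1 : l ≤ 1) (hs : s = 1 + l * (t - 1)) : bernoulliGap q s ≤ bernoulliGap q t := by
  have h := (Real.concaveOn_rpow hq0 hq1).2 (show (1 : ℝ) ∈ Set.Ici 0 by simp) ht
    (show 0 ≤ 1 - l by linarith) hl0 (by ring)
  simp only [smul_eq_mul, Real.one_rpow] at h
  have e : (1 - l) * 1 + l * t = s := by rw [hs]; ring
  rw [e] at h
  have h2 := bernoulliGap_nonneg hq0 hq1 ht
  have h3 : bernoulliGap q s ≤ l * bernoulliGap q t := by
    unfold bernoulliGap; rw [hs] at h ⊢; nlinarith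
  nlinarith

theorem exists_le_bernoulliGap {q δ : ℝ} (hq0 : 0 < q) (hq1 : q < 1) (hδ : 0 < δ) :
    ∃ m > 0, ∀ t, 0 ≤ t → δ ≤ |t - 1| → m ≤ bernoulliGap q t := by
  -- The cap `1 / 2` keeps `1 - d` positive.
  set d := min δ (1 / 2) with hd
  have hd0 : 0 < d := by positivity
  have hd1 : d ≤ 1 / 2 := min_le_right _ _
  refine ⟨min (bernoulliGap q (1 + d)) (bernoulliGap q (1 - d)),
    lt_min (bernoulliGap_pos hq0 hq1 (by linarith) (by linarith))
      (bernoulliGap_pos hq0 hq1 (by linarith) (by linarith)), fun t ht h => ?_⟩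
  have hdt : d ≤ |t - 1| := (min_le_left _ _).trans h
  rcases le_total 0 (t - 1) with h0 | h0
  · rw [abs_of_nonneg h0] at hdt
    refine (min_le_left _ _).trans (bernoulliGap_le hq0.le hq1.le ht (l := d / (t - 1))
      (by positivity) ((div_le_one (by linarith)).2 hdt) ?_)
    rw [div_mul_cancel₀ _ (by linarith)]
  · rw [abs_of_nonpos h0] at hdt
    refine (min_le_right _ _).trans (bernoulliGap_le hq0.le hq1.le ht (l := d / (-(t - 1)))
      (by apply div_nonneg <;> linarith) ((div_le_one (by linarith)).2 hdt) ?_)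
    have : t - 1 ≠ 0 := by linarith
    field_simp
    ring

/-- Nonnegative random variables converge in probability to a constant `c` as soon as their means
are asymptotically at most `c`, and their moments of some order `q < 1` at least `c ^ q`. -/
theorem tendstoInMeasure_of_moments {Ω : Type*} [MeasurableSpace Ω] {μ : Measure Ω}
    [IsProbabilityMeasure μ] {X : ℕ → Ω → ℝ} {q c : ℝ} (hq0 : 0 < q) (hq1 : q < 1) (hc : 0 < c)
    (hX0 : ∀ n ω, 0 ≤ X n ω) (hX : ∀ n, Integrable (X n) μ)
    (hXq : ∀ n, Integrable (fun ω => X n ω ^ q) μ)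
    (hup : ∀ ε > 0, ∀ᶠ n in atTop, ∫ ω, X n ω ∂μ ≤ c + ε)
    (hlow : ∀ ε > 0, ∀ᶠ n in atTop, c ^ q - ε ≤ ∫ ω, X n ω ^ q ∂μ) :
    TendstoInMeasure μ X atTop fun _ => c := by
  rw [tendstoInMeasure_iff_measureReal_dist]
  intro δ hδ
  obtain ⟨m, hm0, hm⟩ := exists_le_bernoulliGap hq0 hq1 (div_pos hδ hc)
  have hcq : 0 < c ^ q := Real.rpow_pos_of_pos hc q
  -- The mean gap depends only on the two moments, and the hypotheses make it small. As the gap is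
  -- at least `m` away from `1`, Markov's inequality concludes.
  have hint : ∀ n, ∫ ω, bernoulliGap q (X n ω / c) ∂μ =
      1 + q * ((∫ ω, X n ω ∂μ) / c - 1) - (∫ ω, X n ω ^ q ∂μ) / c ^ q := by
    intro n
    have e : ∀ ω, bernoulliGap q (X n ω / c) = (1 - q) + q / c * X n ω - X n ω ^ q / c ^ q := by
      intro ω
      rw [bernoulliGap, Real.div_rpow (hX0 n ω) hc.le]; ring
    simp_rw [e]
    have h1 : Integrable (fun ω => (1 - q) + q / c * X n ω) μ :=
      (integrable_const _).add ((hX n).const_mul _)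
    rw [integral_sub h1 ((hXq n).div_const _),
      integral_add (integrable_const _) ((hX n).const_mul _), integral_const_mul, integral_div]
    simp only [integral_const, probReal_univ, one_smul]
    ring
  have hintegrable : ∀ n, Integrable (fun ω => bernoulliGap q (X n ω / c)) μ := by
    intro n
    have e : ∀ ω, bernoulliGap q (X n ω / c) = (1 - q) + q / c * X n ω - X n ω ^ q / c ^ q := by
      intro ω
      rw [bernoulliGap, Real.div_rpow (hX0 n ω) hc.le]; ring
    simp_rw [e]
    exact ((integrable_const _).add ((hX n).const_mul _)).sub ((hXq n).div_const _)
  have hgap0 : ∀ n ω, 0 ≤ bernoulliGap q (X n ω / c) := fun n ω =>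
    bernoulliGap_nonneg hq0.le hq1.le (div_nonneg (hX0 n ω) hc.le)
  have hbound : ∀ n, μ.real {ω | δ ≤ dist (X n ω) c} ≤
      (∫ ω, bernoulliGap q (X n ω / c) ∂μ) / m := by
    intro n
    rw [le_div_iff₀' hm0]
    refine le_trans ?_ (mul_meas_ge_le_integral_of_nonneg (ae_of_all _ (hgap0 n))
      (hintegrable n) m)
    refine mul_le_mul_of_nonneg_left (measureReal_mono fun ω hω => ?_) hm0.le
    refine hm _ (div_nonneg (hX0 n ω) hc.le) ?_
    have h1 : X n ω / c - 1 = (X n ω - c) / c := by field_simp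
    rw [h1, abs_div, abs_of_pos hc]
    exact div_le_div_of_nonneg_right hω hc.le
  rw [Metric.tendsto_atTop']
  intro ε hε
  have h1 := hup (c * (m * ε / 4)) (by positivity)
  have h2 := hlow (c ^ q * (m * ε / 4)) (by positivity)
  obtain ⟨N, hN⟩ := eventually_atTop.1 (h1.and h2)
  refine ⟨N, fun n hn => ?_⟩
  obtain ⟨h3, h4⟩ := hN n hn.le
  rw [Real.dist_eq, sub_zero, abs_of_nonneg measureReal_nonneg]
  refine (hbound n).trans_lt ?_
  rw [div_lt_iff₀ hm0, hint]
  have h5 : (∫ ω, X n ω ∂μ) / c ≤ 1 + m * ε / 4 := by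
    rw [div_le_iff₀ hc]; linarith
  have h6 : 1 - m * ε / 4 ≤ (∫ ω, X n ω ^ q ∂μ) / c ^ q := by
    rw [le_div_iff₀ hcq]; linarith
  have h7 : 0 < m * ε := by positivity
  nlinarith

/-! ### Asymptotics of the two moments -/

theorem eventually_le_mul (C : ℝ) {ε : ℝ} (hε : 0 < ε) : ∀ᶠ n : ℕ in atTop, C ≤ ε * n := by
  filter_upwards [eventually_ge_atTop ⌈C / ε⌉₊] with n hn
  have := Nat.ceil_le.1 hn
  rw [div_le_iff₀ hε] at this
  linarith

theorem exists_rpow_neg_le {α : ℝ} (hα : 0 < α) {ε : ℝ} (hε : 0 < ε) :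
    ∃ A : ℝ, 2 ≤ A ∧ A ^ (-α) ≤ ε := by
  have h := (tendsto_rpow_neg_atTop hα).eventually (ge_mem_nhds hε)
  obtain ⟨A, hA1, hA2⟩ := (h.and (eventually_ge_atTop 2)).exists
  exact ⟨A, hA2, hA1⟩

theorem exists_le_axisGain_add {α A B : ℝ} (hα0 : 0 < α) (hα1 : α < 1) (hA : 0 ≤ A) (hB : 1 ≤ B)
    {ε : ℝ} (hε : 0 < ε) :
    ∃ M, 0 ≤ M ∧ ∀ s : ℕ, 2 * (1 - α) - ε ≤ axisGain α A s + M * logGain B s := by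
  have h1 : Tendsto (fun s : ℕ => (s : ℝ) / (s + (1 + A))) atTop (nhds 1) :=
    tendsto_natCast_div_add_atTop (1 + A)
  have h2 : Tendsto (fun s : ℕ => axisGain α A s) atTop (nhds (2 * (1 - α))) := by
    have := (h1.rpow_const (p := α) (Or.inr hα0.le)).const_mul (2 * (1 - α))
    simpa only [Real.one_rpow, mul_one, ← add_assoc, axisGain] using this
  obtain ⟨K, hK⟩ := eventually_atTop.1 (h2.eventually (le_mem_nhds (by linarith :
    2 * (1 - α) - ε < 2 * (1 - α))))
  -- For `s ≤ K` this `M` gives `M * logGain B s ≥ 2`, more than the missing `2 (1 - α)`; beyond `K`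
  -- the gain alone suffices.
  refine ⟨2 * (4 * (K + 1 + B)), by positivity, fun s => ?_⟩
  have h3 := logGain_nonneg hB s
  rcases le_total K s with h | h
  · have := hK s h
    have h4 : 0 ≤ 2 * (4 * (K + 1 + B)) * logGain B s := by positivity
    linarith
  · have h4 := axisGain_nonneg hα1.le hA s
    have h5 : 2 ≤ 2 * (4 * (K + 1 + B)) * logGain B s := by
      unfold logGain
      rw [mul_one_div, le_div_iff₀ (by positivity)]
      have : (s : ℝ) ≤ K := by exact_mod_cast h
      linarith
    linarith

section Chain
variable {Ω : Type*} [MeasurableSpace Ω] {μ : Measure Ω} [IsProbabilityMeasure μ]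
  {α : ℝ} {Z : ℕ → Ω → ℕ × ℕ}

/-- With `u = y + A` the recursion adds at most `6 + 2 u ^ α` to `u`. Bernoulli's inequality bounds
the growth of `u ^ (1 - α)` by `(1 - α) (2 + 6 u ^ (-α))`, and `u ≥ A`. -/
theorem IsAxisWalk.rpow_integral_size_le (hZ : IsAxisWalk μ α Z) (hα0 : 0 < α) (hα1 : α ≤ 1 / 2)
    {A : ℝ} (hA : 2 ≤ A) (n : ℕ) :
    (∫ ω, (size (phaseStart Z (2 * n) ω) : ℝ) ∂μ + A) ^ (1 - α) ≤
      (∫ ω, (size (phaseStart Z 0 ω) : ℝ) ∂μ + A) ^ (1 - α) +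
        n * ((1 - α) * (2 + 6 * A ^ (-α))) := by
  induction n with
  | zero => simp
  | succ n ih =>
    have hrec := hZ.integral_size_even_succ_le hα0.le hα1 n
    have hy : 0 ≤ ∫ ω, (size (phaseStart Z (2 * n) ω) : ℝ) ∂μ :=
      integral_nonneg fun ω => by positivity
    have hy' : 0 ≤ ∫ ω, (size (phaseStart Z (2 * (n + 1)) ω) : ℝ) ∂μ :=
      integral_nonneg fun ω => by positivity
    generalize ∫ ω, (size (phaseStart Z (2 * (n + 1)) ω) : ℝ) ∂μ = y' at *
    generalize ∫ ω, (size (phaseStart Z (2 * n) ω) : ℝ) ∂μ = y at *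
    have hv : 0 < y + A := by linarith
    have h1 : (y + 2) ^ α ≤ (y + A) ^ α :=
      Real.rpow_le_rpow (by linarith) (by linarith) hα0.le
    have h2 : y' + A ≤ (y + A) * (1 + (6 + 2 * (y + A) ^ α) / (y + A)) := by
      field_simp; linarith
    have h3 : (1 + (6 + 2 * (y + A) ^ α) / (y + A)) ^ (1 - α) ≤
        1 + (1 - α) * ((6 + 2 * (y + A) ^ α) / (y + A)) :=
      rpow_one_add_le_one_add_mul_self
        (by have : 0 ≤ (6 + 2 * (y + A) ^ α) / (y + A) := by positivity
            linarith) (by linarith) (by linarith)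
    have h4 : (y' + A) ^ (1 - α) ≤ (y + A) ^ (1 - α) *
        (1 + (1 - α) * ((6 + 2 * (y + A) ^ α) / (y + A))) := by
      refine (Real.rpow_le_rpow (by linarith) h2 (by linarith)).trans ?_
      rw [Real.mul_rpow hv.le (by positivity)]
      gcongr
    have hva : 0 < (y + A) ^ α := Real.rpow_pos_of_pos hv _
    have h5 : (y + A) ^ (1 - α) * ((6 + 2 * (y + A) ^ α) / (y + A)) =
        6 * (y + A) ^ (-α) + 2 := by
      rw [Real.rpow_sub hv, Real.rpow_one, Real.rpow_neg hv.le]; field_simp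
    have h6 : (y + A) ^ (-α) ≤ A ^ (-α) :=
      Real.rpow_le_rpow_of_nonpos (by linarith) (by linarith) (by linarith)
    have h7 : (y + A) ^ (1 - α) * (1 + (1 - α) * ((6 + 2 * (y + A) ^ α) / (y + A))) =
        (y + A) ^ (1 - α) + (1 - α) * (6 * (y + A) ^ (-α) + 2) := by rw [← h5]; ring
    have h8 : (1 - α) * (6 * (y + A) ^ (-α) + 2) ≤ (1 - α) * (2 + 6 * A ^ (-α)) :=
      mul_le_mul_of_nonneg_left (by linarith) (by linarith)
    push_cast
    linarith

theorem IsAxisWalk.eventually_rpow_integral_size_le (hZ : IsAxisWalk μ α Z) (hα0 : 0 < α)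
    (hα1 : α ≤ 1 / 2) {ε : ℝ} (hε : 0 < ε) :
    ∀ᶠ n : ℕ in atTop, (∫ ω, (size (phaseStart Z (2 * n) ω) : ℝ) ∂μ) ^ (1 - α) ≤
      n * (2 * (1 - α) + ε) := by
  obtain ⟨A, hA, hA'⟩ := exists_rpow_neg_le hα0 (show 0 < ε / 12 by positivity)
  filter_upwards [eventually_le_mul ((∫ ω, (size (phaseStart Z 0 ω) : ℝ) ∂μ + A) ^ (1 - α))
    (half_pos hε)] with n hn
  have h := hZ.rpow_integral_size_le hα0 hα1 hA n
  have h1 : (∫ ω, (size (phaseStart Z (2 * n) ω) : ℝ) ∂μ) ^ (1 - α) ≤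
      (∫ ω, (size (phaseStart Z (2 * n) ω) : ℝ) ∂μ + A) ^ (1 - α) :=
    Real.rpow_le_rpow (integral_nonneg fun ω => by positivity) (by linarith) (by linarith)
  have h2 : (n : ℝ) * ((1 - α) * (2 + 6 * A ^ (-α))) ≤ n * (2 * (1 - α) + ε / 2) := by
    gcongr
    have : 0 ≤ A ^ (-α) := by positivity
    nlinarith
  linarith

/-- The gains telescope against the mean of `logLike`, at most one plus the logarithm of a shifted
mean size. That mean grows polynomially, so its logarithm is `o(n)`. -/
theorem IsAxisWalk.eventually_sum_logGain_le (hZ : IsAxisWalk μ α Z) (hα0 : 0 < α)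
    (hα1 : α ≤ 1 / 2) {A : ℝ} (hA : 2 ≤ A)
    (hA' : ∀ x : ℝ, 0 ≤ x → x ^ (1 - α) ≤ (x + A + 2) / 4) {ε : ℝ} (hε : 0 < ε) :
    ∀ᶠ n : ℕ in atTop, ∑ k ∈ Finset.range n,
      ∫ ω, logGain A (size (phaseStart Z (2 * k + 1) ω)) ∂μ ≤ ε * n := by
  have hA1 : 1 ≤ A := by linarith
  have hq : 0 < 1 - α := by linarith
  have hsum : ∀ n, ∑ k ∈ Finset.range n,
      ∫ ω, logGain A (size (phaseStart Z (2 * k + 1) ω)) ∂μ ≤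
      ∫ ω, logLike A (size (phaseStart Z (2 * n + 1) ω)) ∂μ := by
    intro n
    induction n with
    | zero => simpa using integral_nonneg fun ω => logLike_nonneg hA1 _
    | succ n ih =>
      rw [Finset.sum_range_succ]
      linarith [hZ.integral_logLike_add_le hα0 hα1 hA1 hA' n]
  have hlog : ∀ n, ∫ ω, logLike A (size (phaseStart Z (2 * n + 1) ω)) ∂μ ≤
      1 + Real.log (∫ ω, (size (phaseStart Z (2 * n) ω) : ℝ) ∂μ + A) := by
    intro n
    have hle := hZ.integral_size_odd_le hα0.le hα1 n
    have hy : 0 ≤ ∫ ω, (size (phaseStart Z (2 * n) ω) : ℝ) ∂μ :=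
      integral_nonneg fun ω => by positivity
    set y := ∫ ω, (size (phaseStart Z (2 * n) ω) : ℝ) ∂μ with hydef
    have hv : 0 < y + A := by linarith
    have hi := hZ.integrable_size hα0.le hα1 (2 * n + 1)
    have hi2 : Integrable (fun ω => (y + A)⁻¹ * ((size (phaseStart Z (2 * n + 1) ω) : ℝ) + A) -
      Real.log (y + A)⁻¹) μ := ((hi.add (integrable_const A)).const_mul _).sub (integrable_const _)
    have h1 := integral_mono (hZ.integrable_of_sublinear hα0.le hα1 (2 * n + 1)
      (sublinear_logLike hA1)) hi2 fun ω => logLike_le hA1 _ (inv_pos.2 hv)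
    have hi3 : Integrable (fun ω => (y + A)⁻¹ * ((size (phaseStart Z (2 * n + 1) ω) : ℝ) + A)) μ :=
      (hi.add (integrable_const A)).const_mul _
    rw [integral_sub hi3 (integrable_const _), integral_const_mul, integral_add hi (integrable_const A)] at h1
    simp only [integral_const, probReal_univ, one_smul, Real.log_inv] at h1
    have h2 : (y + A)⁻¹ * (∫ ω, (size (phaseStart Z (2 * n + 1) ω) : ℝ) ∂μ + A) ≤ 1 := by
      rw [inv_mul_le_iff₀ hv]; linarith
    linarith
  set C := (∫ ω, (size (phaseStart Z 0 ω) : ℝ) ∂μ + A) ^ (1 - α) with hC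
  set D := (1 - α) * (2 + 6 * A ^ (-α)) with hD
  have hC0 : 0 ≤ C := by
    have : 0 ≤ ∫ ω, (size (phaseStart Z 0 ω) : ℝ) ∂μ := integral_nonneg fun ω => by positivity
    positivity
  have hD0 : 0 < D := by positivity
  -- Chosen so that `η * D / (1 - α) = ε / 2` in the linear bound `log t ≤ η t - 1 - log η`.
  set η := (1 - α) * ε / (2 * D) with hη
  have hη0 : 0 < η := by positivity
  have hbound : ∀ n : ℕ, Real.log (∫ ω, (size (phaseStart Z (2 * n) ω) : ℝ) ∂μ + A) ≤
      (η * C - Real.log η) / (1 - α) + ε / 2 * n := by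
    intro n
    have h := hZ.rpow_integral_size_le hα0 hα1 hA n
    have hy : 0 ≤ ∫ ω, (size (phaseStart Z (2 * n) ω) : ℝ) ∂μ :=
      integral_nonneg fun ω => by positivity
    generalize ∫ ω, (size (phaseStart Z (2 * n) ω) : ℝ) ∂μ = y at *
    have hv : 0 < y + A := by linarith
    have hp : 0 < (y + A) ^ (1 - α) := Real.rpow_pos_of_pos hv _
    have h1 := Real.log_le_sub_one_of_pos (mul_pos hη0 hp)
    rw [Real.log_mul hη0.ne' hp.ne', Real.log_rpow hv] at h1
    have h2 : η * (y + A) ^ (1 - α) ≤ η * (C + n * D) := by gcongr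
    have h3 : η * D = (1 - α) * (ε / 2) := by rw [hη]; field_simp
    rw [← sub_le_iff_le_add, le_div_iff₀ hq]
    nlinarith
  filter_upwards [eventually_le_mul (1 + (η * C - Real.log η) / (1 - α)) (half_pos hε)] with n hn
  linarith [hsum n, hlog n, hbound n]

theorem IsAxisWalk.eventually_le_integral_dom_rpow (hZ : IsAxisWalk μ α Z) (hα0 : 0 < α)
    (hα1 : α ≤ 1 / 2) {ε : ℝ} (hε : 0 < ε) :
    ∀ᶠ n : ℕ in atTop, n * (2 * (1 - α) - ε) ≤
      ∫ ω, (dom (phaseStart Z (2 * n) ω) : ℝ) ^ (1 - α) ∂μ := by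
  obtain ⟨A, hA, hAε⟩ := exists_rpow_neg_le hα0 (show 0 < ε / 16 by positivity)
  have hA0 : 0 ≤ A := by linarith
  obtain ⟨B₀, hB₀, hB₀'⟩ := exists_rpow_le_div_four hα0 (by linarith)
  -- The shift by one ensures `B ≥ 2` and keeps the inequality for `B₀`.
  set B := B₀ + 1 with hBdef
  have hB : 2 ≤ B := by linarith
  have hB' : ∀ x : ℝ, 0 ≤ x → x ^ (1 - α) ≤ (x + B + 2) / 4 := fun x hx =>
    (hB₀' x hx).trans (by linarith)
  obtain ⟨M, hM0, hM⟩ := exists_le_axisGain_add hα0 (by linarith) hA0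
    (by linarith : (1 : ℝ) ≤ B) (show 0 < ε / 4 by positivity)
  set P := fun n : ℕ => ∫ ω, shiftedPow α A (size (phaseStart Z (2 * n + 1) ω)) ∂μ with hP
  set g := fun n : ℕ => ∫ ω, logGain B (size (phaseStart Z (2 * n + 1) ω)) ∂μ with hg
  -- Half of the loss `ε / 2` is `4 A ^ (-α) ≤ ε / 4`, the other half the deficit of the gain far
  -- from the origin.
  have hstep : ∀ n, P n + (2 * (1 - α) - ε / 2) - M * g n ≤ P (n + 1) := by
    intro n
    have h1 := hZ.integral_shiftedPow_add_le hα0 hα1 (by linarith : 1 ≤ A) n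
    have i1 := hZ.integrable_of_sublinear hα0.le hα1 (2 * n + 1)
      (sublinear_axisGain (α := α) hα0 (by linarith) hA0)
    have i2 := hZ.integrable_of_sublinear hα0.le hα1 (2 * n + 1)
      (sublinear_logGain (by linarith : 1 ≤ B))
    have h2 := integral_mono (integrable_const (2 * (1 - α) - ε / 4)) (i1.add (i2.const_mul M))
      fun ω => hM (size (phaseStart Z (2 * n + 1) ω))
    have h3 : ∫ ω, (axisGain α A (size (phaseStart Z (2 * n + 1) ω)) +
        M * logGain B (size (phaseStart Z (2 * n + 1) ω))) ∂μ =
        ∫ ω, axisGain α A (size (phaseStart Z (2 * n + 1) ω)) ∂μ + M * g n := by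
      rw [integral_add i1 (i2.const_mul M), integral_const_mul]
    simp only [Pi.add_apply] at h2
    rw [h3] at h2
    simp only [integral_const, probReal_univ, one_smul] at h2
    simp only [hP]
    linarith
  have hlow : ∀ n : ℕ, n * (2 * (1 - α) - ε / 2) - M * ∑ k ∈ Finset.range n, g k ≤ P n := by
    intro n
    induction n with
    | zero =>
      simpa using integral_nonneg fun ω => by unfold shiftedPow; positivity
    | succ n ih =>
      rw [Finset.sum_range_succ]
      push_cast
      linarith [hstep n]
  have hdom : ∀ n, P n ≤ ∫ ω, (dom (phaseStart Z (2 * (n + 1)) ω) : ℝ) ^ (1 - α) ∂μ +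
      (1 + A) ^ (1 - α) := by
    intro n
    have h1 := hZ.integral_shiftedPow_le_dom hα0 hα1 hA0 n
    have i1 := hZ.integrable_of_sublinear hα0.le hα1 (2 * (n + 1))
      (sublinear_shiftedPow (α := α) hα0 (by linarith) hA0 (f := fun z => dom z + 1) fun z => by
        have := dom_le_size z
        omega)
    have i2 : Integrable (fun ω => (dom (phaseStart Z (2 * (n + 1)) ω) : ℝ) ^ (1 - α)) μ := by
      simpa [shiftedPow] using hZ.integrable_of_sublinear hα0.le hα1 (2 * (n + 1))
        (sublinear_shiftedPow (α := α) (A := 0) hα0 (by linarith) le_rfl (f := dom) fun z => by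
          have := dom_le_size z
          omega)
    have h2 : ∫ ω, shiftedPow α A (dom (phaseStart Z (2 * (n + 1)) ω) + 1) ∂μ ≤
        ∫ ω, ((dom (phaseStart Z (2 * (n + 1)) ω) : ℝ) ^ (1 - α) + (1 + A) ^ (1 - α)) ∂μ := by
      refine integral_mono i1 (i2.add (integrable_const ((1 + A) ^ (1 - α)))) fun ω => ?_
      have := Real.rpow_add_le_add_rpow (p := 1 - α)
        (Nat.cast_nonneg (α := ℝ) (dom (phaseStart Z (2 * (n + 1)) ω)))
        (by linarith : 0 ≤ 1 + A) (by linarith) (by linarith)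
      simpa only [shiftedPow, Nat.cast_add, Nat.cast_one, add_assoc] using this
    rw [integral_add i2 (integrable_const _)] at h2
    simp only [integral_const, probReal_univ, one_smul] at h2
    exact h1.trans h2
  have hsum := hZ.eventually_sum_logGain_le hα0 hα1 hB hB'
    (show 0 < ε / (8 * (M + 1)) by positivity)
  -- The budget is `ε / 2` from the steps, `ε / 8` from the cycles near the origin and `3 ε / 8` for
  -- the shift of the index and the additive constants.
  obtain ⟨N, hN⟩ := eventually_atTop.1 (hsum.and (eventually_le_mul
    ((1 + A) ^ (1 - α) + 2 * (1 - α)) (show 0 < 3 * ε / 8 by positivity)))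
  filter_upwards [eventually_ge_atTop (N + 1)] with n hn
  obtain ⟨k, rfl⟩ : ∃ k, n = k + 1 := ⟨n - 1, by omega⟩
  obtain ⟨h1, h2⟩ := hN k (by omega)
  have h3 := hlow k
  have h4 := hdom k
  have h5 : M * ∑ j ∈ Finset.range k, g j ≤ ε / 8 * k := by
    refine (mul_le_mul_of_nonneg_left h1 hM0).trans ?_
    have h6 : M * (ε / (8 * (M + 1)) * k) = M / (M + 1) * (ε / 8 * k) := by field_simp
    rw [h6]
    refine mul_le_of_le_one_left (by positivity) ?_
    rw [div_le_one (by positivity)]; linarith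
  push_cast
  linarith

/-! ### Convergence in probability of the dominant coordinate -/

theorem IsAxisWalk.tendstoInMeasure_dom (hZ : IsAxisWalk μ α Z) (hα0 : 0 < α)
    (hα1 : α ≤ 1 / 2) :
    TendstoInMeasure μ
      (fun (n : ℕ) ω => (dom (phaseStart Z (2 * n) ω) : ℝ) / (n : ℝ) ^ (1 / (1 - α)))
      atTop fun _ => (2 * (1 - α)) ^ (1 / (1 - α)) := by
  have hq : 0 < 1 - α := by linarith
  have hsub : ∀ n, Integrable (fun ω => (dom (phaseStart Z (2 * n) ω) : ℝ)) μ := fun n =>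
    hZ.integrable_of_abs_le hα0.le hα1 (2 * n) (F := fun z => (dom z : ℝ)) (C := 1) fun z => by
      have : (dom z : ℝ) ≤ size z := by exact_mod_cast dom_le_size z
      rw [abs_of_nonneg (by positivity)]; linarith
  have hsubq : ∀ n, Integrable (fun ω => (dom (phaseStart Z (2 * n) ω) : ℝ) ^ (1 - α)) μ :=
    fun n => by
      simpa [shiftedPow] using hZ.integrable_of_sublinear hα0.le hα1 (2 * n)
        (sublinear_shiftedPow (α := α) (A := 0) hα0 (by linarith) le_rfl (f := dom) fun z => by
          have := dom_le_size z
          omega)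
  have hpow : ∀ (n : ℕ) ω, ((dom (phaseStart Z (2 * n) ω) : ℝ) / (n : ℝ) ^ (1 / (1 - α))) ^ (1 - α) =
      (dom (phaseStart Z (2 * n) ω) : ℝ) ^ (1 - α) / n := fun n ω => by
    rw [Real.div_rpow (by positivity) (by positivity), ← Real.rpow_mul (by positivity),
      one_div_mul_cancel hq.ne', Real.rpow_one]
  refine tendstoInMeasure_of_moments (q := 1 - α) hq (by linarith)
    (Real.rpow_pos_of_pos (by positivity) _) (fun n ω => by positivity)
    (fun n => (hsub n).div_const _) (fun n => ?_) (fun ε hε => ?_) fun ε hε => ?_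
  · simp_rw [hpow]
    exact (hsubq n).div_const _
  -- The mean is controlled through its power `1 - α`; continuity of the inverse power turns the
  -- error `δ` there into `ε`.
  · have hcont : Tendsto (fun δ : ℝ => (2 * (1 - α) + δ) ^ (1 / (1 - α))) (nhds 0)
        (nhds ((2 * (1 - α)) ^ (1 / (1 - α)))) := by
      have h1 : Tendsto (fun δ : ℝ => 2 * (1 - α) + δ) (nhds 0) (nhds (2 * (1 - α))) := by
        simpa using (tendsto_const_nhds (x := 2 * (1 - α))).add (tendsto_id (α := ℝ) (x := nhds 0))
      exact h1.rpow_const (Or.inr (by positivity))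
    obtain ⟨δ, hδ, hδ0⟩ := (((hcont.mono_left (nhdsWithin_le_nhds (s := Set.Ioi 0))).eventually
      (ge_mem_nhds (lt_add_of_pos_right _ hε))).and self_mem_nhdsWithin).exists
    have hδ0' : 0 < δ := hδ0
    filter_upwards [hZ.eventually_rpow_integral_size_le hα0 hα1 hδ0', eventually_gt_atTop 0]
      with n hn hn0
    have hn0' : (0 : ℝ) < n := by exact_mod_cast hn0
    have hnq : 0 < (n : ℝ) ^ (1 / (1 - α)) := Real.rpow_pos_of_pos hn0' _
    rw [integral_div, div_le_iff₀ hnq]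
    have hy : 0 ≤ ∫ ω, (size (phaseStart Z (2 * n) ω) : ℝ) ∂μ :=
      integral_nonneg fun ω => by positivity
    calc ∫ ω, (dom (phaseStart Z (2 * n) ω) : ℝ) ∂μ
        ≤ ∫ ω, (size (phaseStart Z (2 * n) ω) : ℝ) ∂μ :=
          integral_mono (hsub n) (hZ.integrable_size hα0.le hα1 _) fun ω => by
            simpa using dom_le_size _
      _ = ((∫ ω, (size (phaseStart Z (2 * n) ω) : ℝ) ∂μ) ^ (1 - α)) ^ (1 / (1 - α)) := by
          rw [← Real.rpow_mul hy, mul_one_div_cancel hq.ne', Real.rpow_one]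
      _ ≤ (n * (2 * (1 - α) + δ)) ^ (1 / (1 - α)) := by gcongr
      _ = (2 * (1 - α) + δ) ^ (1 / (1 - α)) * (n : ℝ) ^ (1 / (1 - α)) := by
          rw [Real.mul_rpow hn0'.le (by positivity), mul_comm]
      _ ≤ _ := by gcongr
  · filter_upwards [hZ.eventually_le_integral_dom_rpow hα0 hα1 hε, eventually_gt_atTop 0]
      with n hn hn0
    have hn0' : (0 : ℝ) < n := by exact_mod_cast hn0
    simp_rw [hpow]
    rw [integral_div, le_div_iff₀ hn0', ← Real.rpow_mul (by positivity),
      one_div_mul_cancel hq.ne', Real.rpow_one]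
    linarith

end Chain
end AxisWalk

theorem proposition1 {Ω : Type*} [MeasurableSpace Ω] (μ : Measure Ω) [IsProbabilityMeasure μ]
    (α : ℝ) (hα0 : 0 < α) (hα1 : α < 1 / 2)
    (Z : ℕ → Ω → ℕ × ℕ) (hZ : AxisWalk.IsAxisWalk μ α Z) :
    (∀ i : ℕ, ∀ᵐ ω ∂μ, AxisWalk.rho (fun k => Z k ω) i < ⊤) ∧
    TendstoInMeasure μ
      (fun (i : ℕ) (ω : Ω) =>
        (AxisWalk.dom (Z (AxisWalk.rho (fun k => Z k ω) i).toNat ω) : ℝ) /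
          (i : ℝ) ^ (1 / (1 - α)))
      atTop (fun _ => (2 * (1 - α)) ^ (1 / (1 - α))) := by
  simp only [AxisWalk.rho_eq_crossing]
  exact ⟨fun i => hZ.crossing_lt_top hα0.le hα1.le (2 * i),
    hZ.tendstoInMeasure_dom hα0 hα1.le⟩
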